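/- **Setting.** A two-armed contextual bandit instance $\mathsf P=(\mathbf P_X,\mathbf P^{(1)}_{Y|X},\mathbf P^{(2)}_{Y|X})$ consists of a context distribution $\mathbf P_X$ on $[0,1]^d$ and, for each arm $k\in\{1,2\}$, a conditional distribution of a $\{0,1\}$-valued reward given the context; write $f_k(x)=\mathbb E[Y_k\mid X=x]$. At each time $t$ a context $X_t\sim \mathbf P_X$ is drawn independently of the past, the policy $\pi$ selects an arm $\pi_t$ as a measurable function of $X_1,\dots,X_t$, of the previously observed rewards and of an auxiliary random element $U$, and the reward of that arm is observed. The regret is $\mathcal R^\pi(\mathsf P;T)=\mathbb E\big[\sum_{t=1}^T \max_k f_k(X_t)-f_{\pi_t}(X_t)\big]$. For $\beta>0$ let $\lfloor\beta\rfloor$ be the largest integer strictly less than $\beta$. * *Hölder class* $\mathcal H(\beta,L)$: the $\lfloor\beta\rfloor$ times continuously differentiable $f:[0,1]^d\to\mathbb R$ with $|f(x')-f_x(x')|\le L\|x-x'\|_\infty^\beta$ for all $x,x'$, where $f_x(x')=\sum_{|s|\le\lfloor\beta\rfloor}\frac{(x'-x)^s}{s!}D^sf(x)$. Put $\mathcal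 H(\beta)=\bigcup_L\mathcal H(\beta,L)$. * *Margin condition* $(\alpha,C_0)$: $\mathbf P_X\{0<|f_1(X)-f_2(X)|\le\delta\}\le C_0\delta^\alpha$ for all $0<\delta\le1$. * *Self-similarity* $(\beta,\bar\beta,b,l_0)$: $f_1,f_2\in\mathcal H(\beta)$, and for all integers $l\ge \max\{l_0,0\}$, $q>1$ and $\lfloor\beta\rfloor\le p\le\lfloor\bar\beta\rfloor$, $$\max_{\mathsf B}\max_{k}\sup_{x\in\mathsf B}\big|\Gamma^p_{q^{-l}}f_k(x;\mathsf B)-f_k(x)\big|\ \ge\ b\,q^{-l\beta}.$$ Here $\mathsf B$ ranges over the $q^{ld}$ closed cubes of side $q^{-l}$ that partition $[0,1]^d$ (those of positive $\mathbf P_X$-probability), and $\Gamma^p_hf(x;\mathsf B)=g(x)$, where $g$ minimizes $\int_{\mathsf B}|f(u)-g(u)|^2\,\mathbf 1\{\|x-u\|_\infty\le h\}\,p_X(u\mid\mathsf B)\,du$ over the polynomials of degree at most $p$. Let $\mathcal P^{ss}=\mathcal P^{ss}(\beta,\alpha,d,b,l_0)$, with fixed constants $\bar\beta,L,C_0,\underline\rho,\bar\rho$,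 be the class of instances with $f_1,f_2\in\mathcal H(\beta,L)$, the margin condition $(\alpha,C_0)$, self-similarity $(\beta,\bar\beta,b,l_0)$, and such that $\mathbf P_X$ has a density $p_X$ with $\underline\rho\le p_X\le\bar\rho$ on $[0,1]^d$. Let $\tilde{\mathcal P}^{ss}$ be the class defined in the same way, except that $p_X$ is only required to have a compact support $\mathcal X\subseteq[0,1]^d$ with $\underline\rho\le p_X\le\bar\rho$ on $\mathcal X$. **Theorem.** Let $\beta>0$ be non-integer, $\bar\beta\ge\beta$, and let $\alpha>0$ satisfy $\alpha\le\max\{1,1/\beta\}$ and $\alpha\beta\le d$. There is a $\kappa>0$, depending only on $d,\beta,\bar\beta,\alpha$, and for every $L>0$ there is a $C^*>0$, depending only on $d,\beta,\bar\beta,\alpha,L$, such that the following holds for all $C_0>0$, $0<\underline\rho\le\bar\rho$, $l_0\ge0$ and $0<b\le\kappa\min\{L,2^{l_0\beta}\}$. 1. If $\beta\le1$, $\underline\rho\le1\le\bar\rho$, and either $\alpha\beta<d$ or $C_0\ge C^*$, then there are $T_0$ and $\underline C>0$ such that for every $T\ge T_0$ and every policy $\pi$, $$\sup_{\mathsf P\in\mathcal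 P^{ss}}\mathcal R^\pi(\mathsf P;T)\ \ge\ \underline C\,T^{\,1-\frac{\beta(\alpha+1)}{2\beta+d}}.$$ 2. If $\beta\ge1$ and $\bar\rho>1$, then there are $T_0$ and $\underline C>0$ such that for every $T\ge T_0$ and every policy $\pi$, $$\sup_{\mathsf P\in\tilde{\mathcal P}^{ss}}\mathcal R^\pi(\mathsf P;T)\ \ge\ \underline C\,T^{\,1-\frac{\beta(\alpha+1)}{2\beta+d}}.$$ -/

import Mathlib

open MeasureTheory ProbabilityTheory
open scoped ENNReal

universe u

namespace ContextualBandit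

/-- Contexts are points of `ℝᵈ` (with the sup norm); all context distributions below are carried by
the unit cube. -/
abbrev Ctx (d : ℕ) : Type := Fin d → ℝ

/-- The unit cube `[0,1]ᵈ`. -/
def cube (d : ℕ) : Set (Ctx d) := Set.Icc 0 1

/-- The largest integer that is strictly less than `β`, for `β > 0` (so `1 ↦ 0`). -/
noncomputable def strictFloor (β : ℝ) : ℕ := ⌈β⌉₊ - 1

/-! ### Problem instances -/

/-- A problem instance: a context distribution on `[0,1]ᵈ`, and for each of the two arms a
conditional distribution of the `{0,1}`-valued reward given the context (`true` is the reward `1`).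
The arms are the two elements of `Fin 2`. -/
structure Instance (d : ℕ) where
  /-- the distribution of the contexts -/
  PX : Measure (Ctx d)
  isProb : IsProbabilityMeasure PX
  carried : PX (cube d)ᶜ = 0
  /-- the distribution of the reward, given the arm and the context -/
  reward : Kernel (Fin 2 × Ctx d) Bool
  isMarkov : IsMarkovKernel reward

/-- The payoff function `f_k(x) = E[Y_k | X = x]`. -/
noncomputable def Instance.payoff {d : ℕ} (P : Instance d) (k : Fin 2) (x : Ctx d) : ℝ :=
  (P.reward (k, x)).real {true}

/-! ### Policies and regret -/

/-- An admissible policy: a random element `U` of an arbitrary probability space and, for each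
period `t = 0, 1, 2, …`, a measurable choice of an arm from `U`, the contexts of the periods
`0, …, t` and the rewards observed in the periods `0, …, t - 1`. -/
structure Policy (d : ℕ) where
  𝕌 : Type u
  mU : MeasurableSpace 𝕌
  PU : Measure 𝕌
  isProb : IsProbabilityMeasure PU
  act : (t : ℕ) → 𝕌 × (Fin (t + 1) → Ctx d) × (Fin t → Bool) → Fin 2
  measurable_act : ∀ t, Measurable (act t)

attribute [instance] Policy.mU

namespace Policy

variable {d : ℕ}

/-- What has happened in the first `t` periods: `U`, the contexts, and the observed rewards. -/
abbrev Hist (π : Policy.{u} d) (t : ℕ) : Type u := π.𝕌 × (Fin t → Ctx d) × (Fin t → Bool)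

/-- The arm that is selected in period `t`, given the past and the current context. -/
def choice (π : Policy.{u} d) (t : ℕ) (h : π.Hist t × Ctx d) : Fin 2 :=
  π.act t (h.1.1, Fin.snoc (α := fun _ => Ctx d) h.1.2.1 h.2, h.1.2.2)

theorem measurable_choice (π : Policy.{u} d) (t : ℕ) : Measurable (π.choice t) := by
  refine (π.measurable_act t).comp ?_
  refine Measurable.prodMk (by fun_prop) (Measurable.prodMk ?_ (by fun_prop))
  refine measurable_pi_iff.2 fun i => ?_
  refine Fin.lastCases ?_ (fun j => ?_) i
  · simp only [Fin.snoc_last]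
    fun_prop
  · simp only [Fin.snoc_castSucc]
    fun_prop

/-- The conditional distribution of the reward observed in period `t`, given the past and the
current context. -/
noncomputable def rewardKernel (π : Policy.{u} d) (P : Instance d) (t : ℕ) :
    Kernel (π.Hist t × Ctx d) Bool :=
  P.reward.comap (fun h => (π.choice t h, h.2)) ((π.measurable_choice t).prodMk measurable_snd)

/-- The history after one more period, with the context and the observed reward of that period. -/
def extend (π : Policy.{u} d) (t : ℕ) (w : (π.Hist t × Ctx d) × Bool) : π.Hist (t + 1) :=
  (w.1.1.1, Fin.snoc (α := fun _ => Ctx d) w.1.1.2.1 w.1.2,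
    Fin.snoc (α := fun _ => Bool) w.1.1.2.2 w.2)

/-- The law of the history of the first `t` periods when `π` is run on the instance `P`: in each
period a context is drawn from `P.PX`, independently of the past, and then the reward of the
selected arm is drawn from its conditional distribution. -/
noncomputable def law (π : Policy.{u} d) (P : Instance d) : (t : ℕ) → Measure (π.Hist t)
  | 0 => π.PU.map fun w => (w, fun i => i.elim0, fun i => i.elim0)
  | t + 1 => (((π.law P t).prod P.PX) ⊗ₘ (π.rewardKernel P t)).map (π.extend t)

/-- The arm selected in period `t < T`, as a function of the history of the first `T` periods. -/
def armAt (π : Policy.{u} d) {T : ℕ} (h : π.Hist T) (t : Fin T) : Fin 2 :=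
  π.act t (h.1, fun i => h.2.1 (Fin.castLE t.isLt i), fun i => h.2.2 (Fin.castLE t.isLt.le i))

/-- The expected regret over `T` periods, relative to the oracle that selects the arm with the
larger payoff at each context. -/
noncomputable def regret (π : Policy.{u} d) (P : Instance d) (T : ℕ) : ℝ :=
  ∫ h, (∑ t : Fin T, (max (P.payoff 0 (h.2.1 t)) (P.payoff 1 (h.2.1 t)) -
    P.payoff (π.armAt h t) (h.2.1 t))) ∂(π.law P T)

end Policy

/-! ### Smoothness, self-similarity, margin and density conditions -/

/-- The Taylor polynomial at `x`, of degree `n`, of a function on the cube, evaluated at `x'`: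
the term of order `j` is `∑_{|s| = j} (x' - x)^s / s! * D^s f(x)`, written through the `j`-th
derivative as a multilinear map. -/
noncomputable def taylor {d : ℕ} (f : Ctx d → ℝ) (n : ℕ) (x x' : Ctx d) : ℝ :=
  ∑ j ∈ Finset.range (n + 1),
    ((j.factorial : ℝ)⁻¹) * iteratedFDerivWithin ℝ j f (cube d) x (fun _ => x' - x)

/-- The Hölder class of functions on `[0,1]ᵈ` with exponent `β` and constant `L`. -/
def Holder {d : ℕ} (β L : ℝ) (f : Ctx d → ℝ) : Prop :=
  ContDiffOn ℝ (strictFloor β : ℕ∞) f (cube d) ∧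
    ∀ x ∈ cube d, ∀ x' ∈ cube d, |f x' - taylor f (strictFloor β) x x'| ≤ L * ‖x - x'‖ ^ β

/-- The kernel `K(z) = 1{‖z‖_∞ ≤ 1}`. -/
noncomputable def boxKernel {d : ℕ} (z : Ctx d) : ℝ := if ‖z‖ ≤ 1 then 1 else 0

/-- The weighted squared error
`∫_U |f(u) - g(u)|² K((x - u)/h) p_X(u | U) du` of a polynomial `g`. -/
noncomputable def sqError {d : ℕ} (PX : Measure (Ctx d)) (f : Ctx d → ℝ) (h : ℝ)
    (U : Set (Ctx d)) (x : Ctx d) (g : MvPolynomial (Fin d) ℝ) : ℝ :=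
  ∫ v in U, |f v - MvPolynomial.eval v g| ^ 2 * boxKernel (h⁻¹ • (x - v)) ∂(PX[|U])

/-- `g` minimizes the weighted squared error among the polynomials of degree at most `p`. -/
def IsPolyProj {d : ℕ} (PX : Measure (Ctx d)) (f : Ctx d → ℝ) (p : ℕ) (h : ℝ)
    (U : Set (Ctx d)) (x : Ctx d) (g : MvPolynomial (Fin d) ℝ) : Prop :=
  g.totalDegree ≤ p ∧
    ∀ r : MvPolynomial (Fin d) ℝ, r.totalDegree ≤ p →
      sqError PX f h U x g ≤ sqError PX f h U x r

open Classical in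
/-- The local polynomial projection `Γ_h^p f(x; U)`. -/
noncomputable def polyProj {d : ℕ} (PX : Measure (Ctx d)) (f : Ctx d → ℝ) (p : ℕ) (h : ℝ)
    (U : Set (Ctx d)) (x : Ctx d) : ℝ :=
  if H : ∃ g, IsPolyProj PX f p h U x g then MvPolynomial.eval x H.choose else 0

/-- The hypercubes of side `q^{-l}` that partition `[0,1]ᵈ` (with indices counted from `0`). -/
def bin {d : ℕ} (q l : ℕ) (m : Fin d → Fin (q ^ l)) : Set (Ctx d) :=
  {x | ∀ i, ((m i : ℕ) : ℝ) / (q : ℝ) ^ l ≤ x i ∧ x i ≤ (((m i : ℕ) : ℝ) + 1) / (q : ℝ) ^ l}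

/-- Self-similarity of a pair of payoff functions. The maximum is over the hypercubes of positive
probability, on which the conditional density `p_X(· | B)` is defined; when the density is
positive on the whole cube these are all hypercubes. -/
def SelfSimilar {d : ℕ} (PX : Measure (Ctx d)) (f : Fin 2 → Ctx d → ℝ)
    (β βbar b l₀ : ℝ) : Prop :=
  (∀ k, ∃ L : ℝ, Holder β L (f k)) ∧
    ∀ l q p : ℕ, l₀ ≤ l → 1 < q → strictFloor β ≤ p → p ≤ strictFloor βbar →
      ∃ m : Fin d → Fin (q ^ l), PX (bin q l m) ≠ 0 ∧ ∃ k : Fin 2,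
        ENNReal.ofReal (b * (q : ℝ) ^ (-((l : ℝ) * β))) ≤
          ⨆ x ∈ bin q l m,
            ENNReal.ofReal |polyProj PX (f k) p (((q : ℝ) ^ l)⁻¹) (bin q l m) x - f k x|

/-- The margin condition. -/
def Margin {d : ℕ} (PX : Measure (Ctx d)) (f : Fin 2 → Ctx d → ℝ) (α C₀ : ℝ) : Prop :=
  ∀ δ : ℝ, 0 < δ → δ ≤ 1 →
    PX {x | 0 < |f 0 x - f 1 x| ∧ |f 0 x - f 1 x| ≤ δ} ≤ ENNReal.ofReal (C₀ * δ ^ α)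

/-- `PX` has a density that vanishes off `S` and takes values in `[ρlo, ρhi]` on `S`. -/
def DensityOn {d : ℕ} (PX : Measure (Ctx d)) (S : Set (Ctx d)) (ρlo ρhi : ℝ) : Prop :=
  ∃ p : Ctx d → ℝ, Measurable p ∧ (∀ x ∈ S, ρlo ≤ p x ∧ p x ≤ ρhi) ∧
    PX = (volume.restrict S).withDensity fun x => ENNReal.ofReal (p x)

/-- The class of problems with self-similar payoffs whose context density is bounded from above
and away from zero on the whole cube. -/
def Pss (d : ℕ) (β βbar L α C₀ ρlo ρhi b l₀ : ℝ) : Set (Instance d) :=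
  {P | (∀ k, Holder β L (P.payoff k)) ∧ DensityOn P.PX (cube d) ρlo ρhi ∧
    Margin P.PX P.payoff α C₀ ∧ SelfSimilar P.PX P.payoff β βbar b l₀}

/-- The class of problems with self-similar payoffs whose context density has a compact support in
the cube, and is bounded from above and away from zero on that support. -/
def PssTilde (d : ℕ) (β βbar L α C₀ ρlo ρhi b l₀ : ℝ) : Set (Instance d) :=
  {P | (∀ k, Holder β L (P.payoff k)) ∧
    (∃ S : Set (Ctx d), IsCompact S ∧ S ⊆ cube d ∧ DensityOn P.PX S ρlo ρhi) ∧
    Margin P.PX P.payoff α C₀ ∧ SelfSimilar P.PX P.payoff β βbar b l₀}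

/-- The worst-case regret of a policy over a class of problems; it is `⊥` for the empty class. -/
noncomputable def worstRegret {d : ℕ} (π : Policy.{u} d) (Q : Set (Instance d)) (T : ℕ) : EReal :=
  ⨆ P ∈ Q, ((π.regret P T : ℝ) : EReal)

end ContextualBandit

/-!
The lower bound is of Assouad type. Arm `0` has a fixed rough payoff `g`, and arm `1` has the payoff
`g + Δ_σ`, where `Δ_σ` is a sum of `m` bumps of width `h` and height `a * h ^ β` with disjoint
supports and unknown signs `σ`.

*Self-similarity* comes from `g` alone. Near the face `x_i = 0` it is a constant plus
`c * x_i ^ β`, and on the corner bin of side `q ^ (-l)` every polynomial of degree at most `p`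
misses `x_i ^ β` by a constant times `q ^ (-l * β)`, because `β` is not an integer: the operator
`∏ (f (· / 2) - 2⁻ⁱ f)` annihilates such polynomials but not the power
(`powGap_le_of_abs_sub_le`, `selfSimilar_of_eq_pow`). The local projection on a bin is a single
polynomial there, so it is subject to this bound. The constant `c` may be as large as
`2 ^ (l₀ * β)`, so the power has to be continued to a bounded function with the same
smoothness; an iterated backward difference of `max t 0 ^ β` does this (`exists_rough_profile`).

*Smoothness.* All payoffs are restrictions of functions on the whole space whose derivative of order
`strictFloor β` is Hölder continuous (`HolderDeriv`). This class is stable under rescaling, sums,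
and sums with disjoint supports, with explicit constants, and Taylor's theorem along segments puts
it into the Hölder class of the problem (`HolderDeriv.holder`).

*Information.* Under two sign vectors that differ in one sign, the Hellinger affinity of the laws of
the history shrinks in each period at most by the factor `1 - (2 a h ^ β) ^ 2 * P(cell)`, whatever
the policy does. With `h = T ^ (-1 / (2 β + d))` and `a` small the affinity after `T` periods is at
least `3 / 4`, so the two laws overlap (`quarter_le_lintegral_min`), and for some `σ` a constant
proportion of the visits to the cells goes to the worse arm (`exists_regret_ge`).

*Margin.* The number of cells, about `h ^ (α * β - d)`, is the largest that the margin condition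
allows, and the regret is of order `T * m * h ^ d * h ^ β = T * h ^ (β * (α + 1))`. For `β ≤ 1` the
contexts are uniform and the bumps are tents `(1 - ‖x‖)₊ ^ β`, whose small values are rare enough
because `α ≤ 1 / β`. For `β ≥ 1` the support of the contexts has gaps: it consists of a slab that
carries no bump and of small balls on the plateaus of smooth bumps, so small nonzero values of
`Δ_σ` do not occur at all, and shrinking the balls accommodates every margin constant.
-/

namespace ContextualBandit

/-! ### Integrals with respect to the law of the history -/

attribute [instance] Policy.isProb Instance.isProb Instance.isMarkov

namespace Policy

variable {d : ℕ}

instance isMarkovKernel_rewardKernel (π : Policy.{u} d) (P : Instance d) (t : ℕ) :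
    IsMarkovKernel (π.rewardKernel P t) := by
  unfold rewardKernel; infer_instance

theorem measurable_finSnoc {E : Type*} [MeasurableSpace E] (t : ℕ) :
    Measurable fun w : (Fin t → E) × E =>
      (Fin.snoc (α := fun _ => E) w.1 w.2 : Fin (t + 1) → E) := by
  refine measurable_pi_iff.2 fun i => ?_
  refine Fin.lastCases ?_ (fun j => ?_) i
  · simp only [Fin.snoc_last]
    fun_prop
  · simp only [Fin.snoc_castSucc]
    fun_prop

theorem measurable_extend (π : Policy.{u} d) (t : ℕ) : Measurable (π.extend t) := by
  unfold extend
  refine Measurable.prodMk (by fun_prop) (Measurable.prodMk ?_ ?_)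
  · exact (measurable_finSnoc (E := Ctx d) t).comp
      (g := fun w : (Fin t → Ctx d) × Ctx d => (Fin.snoc (α := fun _ => Ctx d) w.1 w.2))
      (f := fun w : (π.Hist t × Ctx d) × Bool => (w.1.1.2.1, w.1.2)) (by fun_prop)
  · exact (measurable_finSnoc (E := Bool) t).comp
      (g := fun w : (Fin t → Bool) × Bool => (Fin.snoc (α := fun _ => Bool) w.1 w.2))
      (f := fun w : (π.Hist t × Ctx d) × Bool => (w.1.1.2.2, w.2)) (by fun_prop)

instance isProbabilityMeasure_law (π : Policy.{u} d) (P : Instance d) (t : ℕ) :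
    IsProbabilityMeasure (π.law P t) := by
  induction t with
  | zero =>
    exact Measure.isProbabilityMeasure_map (by fun_prop)
  | succ t ih =>
    exact Measure.isProbabilityMeasure_map (π.measurable_extend t).aemeasurable

theorem lintegral_law_succ (π : Policy.{u} d) (P : Instance d) (t : ℕ)
    {F : π.Hist (t + 1) → ℝ≥0∞} (hF : Measurable F) :
    ∫⁻ h, F h ∂(π.law P (t + 1)) =
      ∫⁻ h, ∫⁻ x, ∑ y : Bool, F (π.extend t ((h, x), y)) * P.reward (π.choice t (h, x), x) {y}
        ∂P.PX ∂(π.law P t) := by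
  have hFe : Measurable fun w => F (π.extend t w) := hF.comp (π.measurable_extend t)
  rw [law, lintegral_map hF (π.measurable_extend t), Measure.lintegral_compProd hFe,
    lintegral_prod _ (Measurable.lintegral_kernel_prod_right' hFe).aemeasurable]
  refine lintegral_congr fun h => lintegral_congr fun x => ?_
  rw [lintegral_fintype]
  rfl

theorem armAt_extend_castSucc (π : Policy.{u} d) (t : ℕ) (h : π.Hist t) (x : Ctx d) (y : Bool)
    (s : Fin t) : π.armAt (π.extend t ((h, x), y)) s.castSucc = π.armAt h s := by
  unfold armAt extend
  congr 1
  refine Prod.ext rfl (Prod.ext ?_ ?_)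
  · funext i
    have : (Fin.castLE s.castSucc.isLt i : Fin (t + 1)) = (Fin.castLE s.isLt i).castSucc := rfl
    simp only [this, Fin.snoc_castSucc]
  · funext i
    have : (Fin.castLE s.castSucc.isLt.le i : Fin (t + 1)) =
        (Fin.castLE s.isLt.le i).castSucc := rfl
    simp only [this, Fin.snoc_castSucc]

theorem armAt_extend_last (π : Policy.{u} d) (t : ℕ) (h : π.Hist t) (x : Ctx d) (y : Bool) :
    π.armAt (π.extend t ((h, x), y)) (Fin.last t) = π.choice t (h, x) := by
  unfold armAt extend choice
  congr 1
  refine Prod.ext rfl (Prod.ext ?_ ?_)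
  · funext i
    rfl
  · funext i
    have : (Fin.castLE (Fin.last t).isLt.le i : Fin (t + 1)) = Fin.castSucc i := rfl
    simp only [this, Fin.snoc_castSucc]

theorem measurable_armAt (π : Policy.{u} d) {T : ℕ} (t : Fin T) :
    Measurable fun h : π.Hist T => π.armAt h t := by
  unfold armAt
  refine (π.measurable_act t).comp ?_
  fun_prop

/-- The product over the first `t` periods of a weight that depends on the selected arm, the
context and the observed reward. Likelihood ratios and their square roots are of this form. -/
noncomputable def pathWeight (π : Policy.{u} d) (ω : Fin 2 × Ctx d → Bool → ℝ≥0∞) (t : ℕ)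
    (h : π.Hist t) : ℝ≥0∞ :=
  ∏ s : Fin t, ω (π.armAt h s, h.2.1 s) (h.2.2 s)

theorem measurable_pathWeight (π : Policy.{u} d) {ω : Fin 2 × Ctx d → Bool → ℝ≥0∞}
    (hω : ∀ y, Measurable fun z => ω z y) (t : ℕ) : Measurable (π.pathWeight ω t) := by
  unfold pathWeight
  refine Finset.measurable_prod _ fun s _ => ?_
  have h1 : Measurable fun z : (Fin 2 × Ctx d) × Bool => ω z.1 z.2 :=
    measurable_from_prod_countable_left hω
  exact h1.comp (g := fun z : (Fin 2 × Ctx d) × Bool => ω z.1 z.2)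
    (f := fun h : π.Hist t => ((π.armAt h s, h.2.1 s), h.2.2 s))
    (((π.measurable_armAt s).prodMk (by fun_prop)).prodMk (by fun_prop))

theorem pathWeight_extend (π : Policy.{u} d) (ω : Fin 2 × Ctx d → Bool → ℝ≥0∞) (t : ℕ)
    (h : π.Hist t) (x : Ctx d) (y : Bool) :
    π.pathWeight ω (t + 1) (π.extend t ((h, x), y)) =
      π.pathWeight ω t h * ω (π.choice t (h, x), x) y := by
  unfold pathWeight
  rw [Fin.prod_univ_castSucc, armAt_extend_last]
  congr 1
  · refine Finset.prod_congr rfl fun s _ => ?_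
    rw [armAt_extend_castSucc]
    simp [extend]
  · simp [extend]

/-- Change of measure: if the reward distributions of `P` have the density `ω` with respect to those
of `P₀`, then the law of the history has the density `pathWeight ω`. -/
theorem lintegral_law_eq_pathWeight (π : Policy.{u} d) {P P₀ : Instance d} (hPX : P.PX = P₀.PX)
    {ω : Fin 2 × Ctx d → Bool → ℝ≥0∞} (hω : ∀ y, Measurable fun z => ω z y)
    (hP : ∀ z y, P.reward z {y} = ω z y * P₀.reward z {y}) (t : ℕ)
    {F : π.Hist t → ℝ≥0∞} (hF : Measurable F) :
    ∫⁻ h, F h ∂(π.law P t) = ∫⁻ h, π.pathWeight ω t h * F h ∂(π.law P₀ t) := by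
  induction t with
  | zero =>
    simp [pathWeight, law]
  | succ t ih =>
    have hFe : Measurable fun w => F (π.extend t w) := hF.comp (π.measurable_extend t)
    have hr : ∀ y, Measurable fun w : π.Hist t × Ctx d => P.reward (π.choice t w, w.2) {y} :=
      fun y => (P.reward.measurable_coe (measurableSet_singleton y)).comp
        ((π.measurable_choice t).prodMk measurable_snd)
    have hG : ∀ y, Measurable fun w : π.Hist t × Ctx d =>
        F (π.extend t (w, y)) * P.reward (π.choice t w, w.2) {y} := fun y =>
      (hFe.comp (measurable_id.prodMk measurable_const)).mul (hr y)
    have hG' : Measurable fun w : π.Hist t × Ctx d =>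
        ∑ y : Bool, F (π.extend t (w, y)) * P.reward (π.choice t w, w.2) {y} :=
      Finset.measurable_sum _ fun y _ => hG y
    rw [lintegral_law_succ π P t hF,
      lintegral_law_succ π P₀ t (F := fun h => π.pathWeight ω (t + 1) h * F h)
        ((π.measurable_pathWeight hω _).mul hF),
      ih (Measurable.lintegral_prod_right' (ν := P.PX) hG')]
    refine lintegral_congr fun h => ?_
    have hGh : Measurable fun x : Ctx d =>
        ∑ y : Bool, F (π.extend t ((h, x), y)) * P.reward (π.choice t (h, x), x) {y} :=
      hG'.comp measurable_prodMk_left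
    refine (lintegral_const_mul _ hGh).symm.trans ?_
    rw [hPX]
    refine lintegral_congr fun x => ?_
    rw [Finset.mul_sum]
    refine Finset.sum_congr rfl fun y _ => ?_
    rw [pathWeight_extend, hP]
    ring

/-- A path weight whose conditional one-step mean is at least `r` has mean at least `r ^ t`. -/
theorem pow_le_lintegral_pathWeight (π : Policy.{u} d) (P₀ : Instance d)
    {ω : Fin 2 × Ctx d → Bool → ℝ≥0∞} (hω : ∀ y, Measurable fun z => ω z y)
    {v : Ctx d → ℝ≥0∞} {r : ℝ≥0∞}
    (hv : ∀ k x, v x ≤ ∑ y : Bool, ω (k, x) y * P₀.reward (k, x) {y})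
    (hr : r ≤ ∫⁻ x, v x ∂P₀.PX) (t : ℕ) :
    r ^ t ≤ ∫⁻ h, π.pathWeight ω t h ∂(π.law P₀ t) := by
  induction t with
  | zero => simp [pathWeight]
  | succ t ih =>
    rw [lintegral_law_succ π P₀ t (π.measurable_pathWeight hω _), pow_succ]
    calc r ^ t * r ≤ (∫⁻ h, π.pathWeight ω t h ∂(π.law P₀ t)) * r := by gcongr
      _ = ∫⁻ h, π.pathWeight ω t h * r ∂(π.law P₀ t) :=
        (lintegral_mul_const _ (π.measurable_pathWeight hω _)).symm
      _ ≤ _ := by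
        refine lintegral_mono fun h => ?_
        refine (mul_le_mul_right hr _).trans ((lintegral_const_mul_le _ _).trans
          (lintegral_mono fun x => ?_))
        refine (mul_le_mul_right (hv (π.choice t (h, x)) x) _).trans_eq ?_
        rw [Finset.mul_sum]
        refine Finset.sum_congr rfl fun y _ => ?_
        rw [pathWeight_extend]
        ring

/-- The loss, relative to the better arm, of pulling arm `k` at the context `x`. -/
noncomputable def gap (P : Instance d) (k : Fin 2) (x : Ctx d) : ℝ :=
  max (P.payoff 0 x) (P.payoff 1 x) - P.payoff k x

theorem gap_nonneg (P : Instance d) (k : Fin 2) (x : Ctx d) : 0 ≤ gap P k x := by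
  unfold gap
  fin_cases k <;> simp

theorem gap_le_one (P : Instance d) (k : Fin 2) (x : Ctx d) : gap P k x ≤ 1 := by
  have h1 : ∀ k, P.payoff k x ≤ 1 := fun k => measureReal_le_one
  have h0 : 0 ≤ P.payoff k x := measureReal_nonneg
  have := max_le (h1 0) (h1 1)
  unfold gap
  linarith

theorem measurable_gap (P : Instance d) : Measurable fun z : Fin 2 × Ctx d => gap P z.1 z.2 := by
  have h : ∀ k, Measurable (P.payoff k) := fun k =>
    ((P.reward.measurable_coe (measurableSet_singleton true)).comp
      (measurable_const.prodMk measurable_id)).ennreal_toReal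
  exact measurable_from_prod_countable_right fun k => ((h 0).max (h 1)).sub (h k)

theorem lintegral_sum_gap (π : Policy.{u} d) (P : Instance d) (T : ℕ) :
    ∫⁻ h, ∑ t : Fin T, ENNReal.ofReal (gap P (π.armAt h t) (h.2.1 t)) ∂(π.law P T) =
      ∑ t ∈ Finset.range T, ∫⁻ h, ∫⁻ x, ENNReal.ofReal (gap P (π.choice t (h, x)) x) ∂P.PX
        ∂(π.law P t) := by
  induction T with
  | zero => simp
  | succ T ih =>
    have hm : ∀ {n : ℕ} (t : Fin n), Measurable fun h : π.Hist n =>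
        ENNReal.ofReal (gap P (π.armAt h t) (h.2.1 t)) := fun {n} t =>
      ((measurable_gap P).comp (g := fun z : Fin 2 × Ctx d => gap P z.1 z.2)
        (f := fun h : π.Hist n => (π.armAt h t, h.2.1 t))
        ((π.measurable_armAt t).prodMk (by fun_prop))).ennreal_ofReal
    have hc : Measurable fun w : π.Hist T × Ctx d =>
        ENNReal.ofReal (gap P (π.choice T w) w.2) :=
      ((measurable_gap P).comp (g := fun z : Fin 2 × Ctx d => gap P z.1 z.2)
        (f := fun w : π.Hist T × Ctx d => (π.choice T w, w.2))
        ((π.measurable_choice T).prodMk measurable_snd)).ennreal_ofReal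
    rw [lintegral_law_succ π P T (Finset.measurable_sum _ fun t _ => hm t),
      Finset.sum_range_succ, ← ih, ← lintegral_add_left (Finset.measurable_sum _ fun t _ => hm t)]
    refine lintegral_congr fun h => ?_
    have hsum : ∀ x, ∑ y : Bool, P.reward (π.choice T (h, x), x) {y} = 1 := fun x => by
      rw [sum_measure_singleton, Finset.coe_univ, measure_univ]
    rw [← one_mul (∑ t : Fin T, _), ← measure_univ (μ := P.PX), mul_comm, ← lintegral_const,
      ← lintegral_add_left measurable_const]
    refine lintegral_congr fun x => ?_
    rw [← mul_one (∑ t : Fin T, _ + _), ← hsum x, Finset.mul_sum]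
    refine Finset.sum_congr rfl fun y _ => ?_
    rw [Fin.sum_univ_castSucc, armAt_extend_last]
    congr 2
    · refine Finset.sum_congr rfl fun s _ => ?_
      rw [armAt_extend_castSucc]
      simp [extend]
    · simp [extend]

theorem ofReal_regret (π : Policy.{u} d) (P : Instance d) (T : ℕ) :
    ENNReal.ofReal (π.regret P T) =
      ∑ t ∈ Finset.range T, ∫⁻ h, ∫⁻ x, ENNReal.ofReal (gap P (π.choice t (h, x)) x) ∂P.PX
        ∂(π.law P t) := by
  have hm : ∀ t : Fin T, Measurable fun h : π.Hist T => gap P (π.armAt h t) (h.2.1 t) := fun t =>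
    (measurable_gap P).comp (g := fun z : Fin 2 × Ctx d => gap P z.1 z.2)
      (f := fun h : π.Hist T => (π.armAt h t, h.2.1 t))
      ((π.measurable_armAt t).prodMk (by fun_prop))
  have hint : Integrable (fun h : π.Hist T => ∑ t : Fin T, gap P (π.armAt h t) (h.2.1 t))
      (π.law P T) := by
    refine integrable_finsetSum _ fun t _ => Integrable.of_bound (hm t).aestronglyMeasurable 1
      (Filter.Eventually.of_forall fun h => ?_)
    rw [Real.norm_of_nonneg (gap_nonneg P _ _)]
    exact gap_le_one P _ _
  rw [← lintegral_sum_gap]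
  unfold regret
  change ENNReal.ofReal (∫ h, ∑ t : Fin T, gap P (π.armAt h t) (h.2.1 t) ∂_) = _
  rw [ofReal_integral_eq_lintegral_ofReal hint
    (Filter.Eventually.of_forall fun h => Finset.sum_nonneg fun t _ => gap_nonneg P _ _)]
  refine lintegral_congr fun h => ?_
  rw [ENNReal.ofReal_sum_of_nonneg fun t _ => gap_nonneg P _ _]

end Policy

/-! ### Instances with prescribed payoff functions -/

/-- The probability of the reward `y` under the Bernoulli distribution with mean `p`. -/
def bern (p : ℝ) (y : Bool) : ℝ := if y then p else 1 - p

theorem bern_nonneg {p : ℝ} (hp : p ∈ Set.Icc (0 : ℝ) 1) (y : Bool) : 0 ≤ bern p y := by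
  cases y <;> simp [bern, hp.1, hp.2]

theorem measurable_bern (y : Bool) : Measurable fun p => bern p y := by
  cases y
  · exact measurable_const.sub measurable_id
  · exact measurable_id

variable {d : ℕ}

/-- The instance with context distribution `PX` whose arm `k` has the payoff function `f k`. -/
noncomputable def bernoulliInstance (PX : Measure (Ctx d)) (hprob : IsProbabilityMeasure PX)
    (hcube : PX (cube d)ᶜ = 0) (f : Fin 2 → Ctx d → ℝ) (hf : ∀ k, Measurable (f k))
    (hf01 : ∀ k x, f k x ∈ Set.Icc (0 : ℝ) 1) : Instance d where
  PX := PX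
  isProb := hprob
  carried := hcube
  reward :=
    { toFun := fun z => ∑ y : Bool, ENNReal.ofReal (bern (f z.1 z.2) y) • Measure.dirac y
      measurable' := by
        refine Measure.measurable_of_measurable_coe _ fun s hs => ?_
        have hfz : Measurable fun z : Fin 2 × Ctx d => f z.1 z.2 :=
          measurable_from_prod_countable_right hf
        simp only [Measure.coe_finsetSum, Finset.sum_apply, Measure.smul_apply, smul_eq_mul]
        exact Finset.measurable_sum _ fun y _ =>
          (((measurable_bern y).comp hfz).ennreal_ofReal).mul_const _ }
  isMarkov := ⟨fun z => ⟨by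
    have h := hf01 z.1 z.2
    have h1 : 0 ≤ 1 - f z.1 z.2 := by linarith [h.2]
    simp only [Kernel.coe_mk, Fintype.sum_bool, bern]
    simp [← ENNReal.ofReal_add h.1 h1]⟩⟩

section bernoulliInstance

variable {PX : Measure (Ctx d)} {hprob : IsProbabilityMeasure PX} {hcube : PX (cube d)ᶜ = 0}
  {f : Fin 2 → Ctx d → ℝ} {hf : ∀ k, Measurable (f k)} {hf01 : ∀ k x, f k x ∈ Set.Icc (0 : ℝ) 1}

theorem bernoulliInstance_reward (z : Fin 2 × Ctx d) (y : Bool) :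
    (bernoulliInstance PX hprob hcube f hf hf01).reward z {y} =
      ENNReal.ofReal (bern (f z.1 z.2) y) := by
  change (∑ y : Bool, ENNReal.ofReal (bern (f z.1 z.2) y) • Measure.dirac y) {y} = _
  cases y <;> simp

theorem bernoulliInstance_payoff (k : Fin 2) :
    (bernoulliInstance PX hprob hcube f hf hf01).payoff k = f k := by
  funext x
  rw [Instance.payoff, Measure.real, bernoulliInstance_reward,
    ENNReal.toReal_ofReal (bern_nonneg (hf01 k x) true)]
  rfl

end bernoulliInstance

/-! ### Affinity of the histories under two instances -/

/-- Lower bound for the Hellinger affinity of two Bernoulli distributions whose means stay away from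
`0` and `1`. -/
theorem one_sub_sq_le_affinity {p q : ℝ} (hp : p ∈ Set.Icc (1 / 4 : ℝ) (3 / 4))
    (hq : q ∈ Set.Icc (1 / 4 : ℝ) (3 / 4)) :
    1 - (p - q) ^ 2 ≤ ∑ y : Bool, √(bern p y * bern q y) := by
  -- `(√p - √q)² ≤ (p - q)²` because `√p + √q ≥ 1`
  have key : ∀ {p q : ℝ}, 1 / 4 ≤ p → 1 / 4 ≤ q → (p + q - (p - q) ^ 2) / 2 ≤ √(p * q) := by
    intro p q hp hq
    have h1 : (1 / 2 : ℝ) ≤ √p := Real.le_sqrt_of_sq_le (by linarith)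
    have h2 : (1 / 2 : ℝ) ≤ √q := Real.le_sqrt_of_sq_le (by linarith)
    have h3 := Real.sq_sqrt (show 0 ≤ p by linarith)
    have h4 := Real.sq_sqrt (show 0 ≤ q by linarith)
    rw [Real.sqrt_mul (by linarith)]
    have h5 : (1 : ℝ) ≤ (√p + √q) ^ 2 := by nlinarith
    have h6 : (p - q) ^ 2 = (√p - √q) ^ 2 * (√p + √q) ^ 2 := by
      rw [← mul_pow, ← h3, ← h4]
      simp only [Real.sqrt_sq (Real.sqrt_nonneg _)]
      ring
    nlinarith [mul_le_mul_of_nonneg_left h5 (sq_nonneg (√p - √q))]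
  have h1 := key hp.1 hq.1
  have h2 := key (p := 1 - p) (q := 1 - q) (by linarith [hp.2]) (by linarith [hq.2])
  simp only [Fintype.sum_bool, bern, if_true, Bool.false_eq_true, if_false]
  nlinarith

theorem le_max_add_min_of_sq_eq {a b w : ℝ≥0∞} (h : w ^ 2 = a * b) :
    w ≤ (a + b) / 8 + 2 * min a b := by
  by_cases ha : a = ∞
  · simp [ha, ENNReal.top_div]
  by_cases hb : b = ∞
  · simp [hb, ENNReal.top_div]
  have hw : w ≠ ∞ := by
    rintro rfl
    have : a * b ≠ ∞ := ENNReal.mul_ne_top ha hb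
    simp [← h] at this
  lift a to NNReal using ha
  lift b to NNReal using hb
  lift w to NNReal using hw
  have h' : (w : ℝ) ^ 2 = a * b := by exact_mod_cast h
  have hm : ((min (a : ℝ≥0∞) b : ℝ≥0∞)) = ((min a b : NNReal) : ℝ≥0∞) := by
    rw [ENNReal.coe_min]
  rw [hm]
  have : w ≤ (a + b) / 8 + 2 * min a b := by
    rw [← NNReal.coe_le_coe]
    push_cast
    have ha0 : (0 : ℝ) ≤ a := a.2
    have hb0 : (0 : ℝ) ≤ b := b.2
    refine abs_le_of_sq_le_sq' ?_ (by positivity) |>.2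
    rw [h']
    rcases le_total (a : ℝ) b with hab | hab
    · rw [min_eq_left hab]
      nlinarith [sq_nonneg ((b : ℝ) / 8 - 2 * a)]
    · rw [min_eq_right hab]
      nlinarith [sq_nonneg ((a : ℝ) / 8 - 2 * b)]
  have h8 : (8 : ℝ≥0∞) = ((8 : NNReal) : ℝ≥0∞) := rfl
  have h2 : (2 : ℝ≥0∞) = ((2 : NNReal) : ℝ≥0∞) := rfl
  rw [h8, h2, ← ENNReal.coe_add, ← ENNReal.coe_div (by norm_num), ← ENNReal.coe_mul,
    ← ENNReal.coe_add]
  exact_mod_cast this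

/-- The likelihood ratio of one reward, with respect to a fair coin. -/
noncomputable def coinRatio (f : Fin 2 → Ctx d → ℝ) (z : Fin 2 × Ctx d) (y : Bool) : ℝ≥0∞ :=
  ENNReal.ofReal (2 * bern (f z.1 z.2) y)

theorem measurable_coinRatio {f : Fin 2 → Ctx d → ℝ} (hf : ∀ k, Measurable (f k)) (y : Bool) :
    Measurable fun z => coinRatio f z y := by
  have hfz : Measurable fun z : Fin 2 × Ctx d => f z.1 z.2 :=
    measurable_from_prod_countable_right hf
  exact (((measurable_bern y).comp hfz).const_mul 2).ennreal_ofReal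

/-- The instance in which every reward is a fair coin; it serves as the dominating instance. -/
noncomputable def coinInstance (PX : Measure (Ctx d)) (hprob : IsProbabilityMeasure PX)
    (hcube : PX (cube d)ᶜ = 0) : Instance d :=
  bernoulliInstance PX hprob hcube (fun _ _ => 1 / 2) (fun _ => measurable_const)
    (fun _ _ => Set.mem_Icc.2 ⟨by norm_num, by norm_num⟩)

theorem coinInstance_reward {PX : Measure (Ctx d)} {hprob : IsProbabilityMeasure PX}
    {hcube : PX (cube d)ᶜ = 0} (z : Fin 2 × Ctx d) (y : Bool) :
    (coinInstance PX hprob hcube).reward z {y} = ENNReal.ofReal (1 / 2) := by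
  rw [coinInstance, bernoulliInstance_reward]
  cases y <;> norm_num [bern]

theorem lintegral_law_bernoulliInstance (π : Policy.{u} d) {PX : Measure (Ctx d)}
    (hprob : IsProbabilityMeasure PX) (hcube : PX (cube d)ᶜ = 0) {f : Fin 2 → Ctx d → ℝ}
    (hf : ∀ k, Measurable (f k)) (hf01 : ∀ k x, f k x ∈ Set.Icc (0 : ℝ) 1) (t : ℕ)
    {F : π.Hist t → ℝ≥0∞} (hF : Measurable F) :
    ∫⁻ h, F h ∂(π.law (bernoulliInstance PX hprob hcube f hf hf01) t) =
      ∫⁻ h, π.pathWeight (coinRatio f) t h * F h ∂(π.law (coinInstance PX hprob hcube) t) := by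
  refine π.lintegral_law_eq_pathWeight (P := bernoulliInstance PX hprob hcube f hf hf01)
    (P₀ := coinInstance PX hprob hcube) rfl (measurable_coinRatio hf) (fun z y => ?_) t hF
  rw [bernoulliInstance_reward, coinInstance_reward, coinRatio,
    ← ENNReal.ofReal_mul (by linarith [bern_nonneg (hf01 z.1 z.2) y])]
  congr 1
  ring

/-- If the payoffs of two instances differ by at most `δ`, and only on a set of probability at most
`w`, then as long as `t * δ ^ 2 * w ≤ 1 / 4` the laws of the history overlap by at least `1 / 4`. -/
theorem quarter_le_lintegral_min (π : Policy.{u} d) {PX : Measure (Ctx d)}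
    (hprob : IsProbabilityMeasure PX) (hcube : PX (cube d)ᶜ = 0) {f f' : Fin 2 → Ctx d → ℝ}
    (hf : ∀ k, Measurable (f k)) (hf' : ∀ k, Measurable (f' k))
    (hf4 : ∀ k x, f k x ∈ Set.Icc (1 / 4 : ℝ) (3 / 4))
    (hf4' : ∀ k x, f' k x ∈ Set.Icc (1 / 4 : ℝ) (3 / 4))
    {A : Set (Ctx d)} (hA : MeasurableSet A) {δ w : ℝ} (hw : PX.real A ≤ w)
    (hoff : ∀ k, ∀ x ∉ A, f k x = f' k x) (hon : ∀ k, ∀ x ∈ A, |f k x - f' k x| ≤ δ)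
    {t : ℕ} (ht : t * (δ ^ 2 * w) ≤ 1 / 4) :
    1 / 4 ≤ ∫⁻ h, min (π.pathWeight (coinRatio f) t h) (π.pathWeight (coinRatio f') t h)
      ∂(π.law (coinInstance PX hprob hcube) t) := by
  have h01 : ∀ {f : Fin 2 → Ctx d → ℝ}, (∀ k x, f k x ∈ Set.Icc (1 / 4 : ℝ) (3 / 4)) →
      ∀ k x, f k x ∈ Set.Icc (0 : ℝ) 1 := fun hf k x =>
    ⟨by linarith [(hf k x).1], by linarith [(hf k x).2]⟩
  set Q := coinInstance PX hprob hcube with hQ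
  -- the square root of the product of the two likelihood ratios
  let ω : Fin 2 × Ctx d → Bool → ℝ≥0∞ := fun z y =>
    ENNReal.ofReal (2 * √(bern (f z.1 z.2) y * bern (f' z.1 z.2) y))
  have hω : ∀ y, Measurable fun z => ω z y := fun y => by
    have hfz : Measurable fun z : Fin 2 × Ctx d => f z.1 z.2 :=
      measurable_from_prod_countable_right hf
    have hfz' : Measurable fun z : Fin 2 × Ctx d => f' z.1 z.2 :=
      measurable_from_prod_countable_right hf'
    exact ((((measurable_bern y).comp hfz).mul
      ((measurable_bern y).comp hfz')).sqrt.const_mul 2).ennreal_ofReal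
  have hsq : ∀ h, π.pathWeight ω t h ^ 2 =
      π.pathWeight (coinRatio f) t h * π.pathWeight (coinRatio f') t h := fun h => by
    simp only [Policy.pathWeight, ← Finset.prod_pow, ← Finset.prod_mul_distrib]
    refine Finset.prod_congr rfl fun s _ => ?_
    simp only [ω, coinRatio]
    have b1 := bern_nonneg (h01 hf4 (π.armAt h s) (h.2.1 s)) (h.2.2 s)
    have b2 := bern_nonneg (h01 hf4' (π.armAt h s) (h.2.1 s)) (h.2.2 s)
    rw [← ENNReal.ofReal_pow (by positivity), ← ENNReal.ofReal_mul (by positivity), mul_pow,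
      Real.sq_sqrt (mul_nonneg b1 b2)]
    congr 1
    ring
  have hmass : ∀ {f : Fin 2 → Ctx d → ℝ} (_ : ∀ k, Measurable (f k))
      (_ : ∀ k x, f k x ∈ Set.Icc (1 / 4 : ℝ) (3 / 4)),
      ∫⁻ h, π.pathWeight (coinRatio f) t h ∂(π.law Q t) = 1 := fun {f} hf hf4 => by
    have := lintegral_law_bernoulliInstance π hprob hcube hf (h01 hf4) t
      (F := fun _ => 1) measurable_const
    simpa using this.symm
  have hstep : ENNReal.ofReal (1 - δ ^ 2 * w) ≤
      ∫⁻ x, ENNReal.ofReal (1 - δ ^ 2 * A.indicator 1 x) ∂PX := by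
    have hint : Integrable (A.indicator (1 : Ctx d → ℝ)) PX :=
      (integrable_indicator_iff hA).2 (integrable_const _).integrableOn
    by_cases hneg : 1 - δ ^ 2 * w ≤ 0
    · simp [ENNReal.ofReal_of_nonpos hneg]
    calc ENNReal.ofReal (1 - δ ^ 2 * w)
        ≤ ENNReal.ofReal (∫ x, (1 - δ ^ 2 * A.indicator 1 x) ∂PX) := by
          refine ENNReal.ofReal_le_ofReal ?_
          rw [integral_sub (integrable_const _) (hint.const_mul _), integral_const_mul,
            integral_indicator_one hA]
          simp only [integral_const, probReal_univ, smul_eq_mul, mul_one]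
          have := mul_le_mul_of_nonneg_left hw (sq_nonneg δ)
          linarith
      _ ≤ _ := by
          refine ENNReal.ofReal_le_of_le_toReal ?_
          have := integral_eq_lintegral_pos_part_sub_lintegral_neg_part
            (f := fun x => 1 - δ ^ 2 * A.indicator (1 : Ctx d → ℝ) x)
            ((integrable_const 1).sub (hint.const_mul (δ ^ 2)))
          linarith [ENNReal.toReal_nonneg
            (a := ∫⁻ x, ENNReal.ofReal (-(1 - δ ^ 2 * A.indicator (1 : Ctx d → ℝ) x)) ∂PX)]
  have haff := π.pow_le_lintegral_pathWeight Q hω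
    (v := fun x => ENNReal.ofReal (1 - δ ^ 2 * A.indicator 1 x)) (fun k x => by
      have hδ : (f k x - f' k x) ^ 2 ≤ δ ^ 2 * A.indicator 1 x := by
        by_cases hx : x ∈ A
        · simpa [hx] using sq_le_sq' (abs_le.1 (hon k x hx)).1 (abs_le.1 (hon k x hx)).2
        · simp [hx, hoff k x hx]
      refine (ENNReal.ofReal_le_ofReal ((sub_le_sub_left hδ 1).trans
        (one_sub_sq_le_affinity (hf4 k x) (hf4' k x)))).trans_eq ?_
      rw [ENNReal.ofReal_sum_of_nonneg fun _ _ => Real.sqrt_nonneg _]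
      refine Finset.sum_congr rfl fun y _ => ?_
      rw [coinInstance_reward, ← ENNReal.ofReal_mul (by positivity)]
      congr 1
      ring) hstep t
  have h34 : ENNReal.ofReal (3 / 4) ≤ ∫⁻ h, π.pathWeight ω t h ∂(π.law Q t) := by
    refine le_trans ?_ haff
    rcases Nat.eq_zero_or_pos t with rfl | htpos
    · simp only [pow_zero]
      rw [← ENNReal.ofReal_one]
      exact ENNReal.ofReal_le_ofReal (by norm_num)
    have hδw : 0 ≤ δ ^ 2 * w := mul_nonneg (sq_nonneg _) (measureReal_nonneg.trans hw)
    have hle1 : δ ^ 2 * w ≤ 1 / 4 := by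
      refine le_trans ?_ ht
      have : (1 : ℝ) ≤ t := by exact_mod_cast htpos
      nlinarith
    rw [← ENNReal.ofReal_pow (by linarith)]
    refine ENNReal.ofReal_le_ofReal ?_
    have := one_add_mul_le_pow (a := -(δ ^ 2 * w)) (by linarith) t
    rw [sub_eq_add_neg]
    linarith
  have hmin : Measurable fun h =>
      min (π.pathWeight (coinRatio f) t h) (π.pathWeight (coinRatio f') t h) :=
    (π.measurable_pathWeight (measurable_coinRatio hf) t).min
      (π.measurable_pathWeight (measurable_coinRatio hf') t)
  set I := ∫⁻ h, min (π.pathWeight (coinRatio f) t h) (π.pathWeight (coinRatio f') t h)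
    ∂(π.law Q t) with hI
  have hup : ∫⁻ h, π.pathWeight ω t h ∂(π.law Q t) ≤ (1 + 1) / 8 + 2 * I := by
    calc ∫⁻ h, π.pathWeight ω t h ∂(π.law Q t)
        ≤ ∫⁻ h, ((π.pathWeight (coinRatio f) t h + π.pathWeight (coinRatio f') t h) / 8 +
          2 * min (π.pathWeight (coinRatio f) t h) (π.pathWeight (coinRatio f') t h))
            ∂(π.law Q t) := lintegral_mono fun h => le_max_add_min_of_sq_eq (hsq h)
      _ = _ := by
        rw [lintegral_add_right _ (hmin.const_mul 2), lintegral_const_mul _ hmin]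
        simp only [div_eq_mul_inv]
        have hsum : Measurable fun h =>
            π.pathWeight (coinRatio f) t h + π.pathWeight (coinRatio f') t h :=
          (π.measurable_pathWeight (measurable_coinRatio hf) t).add
            (π.measurable_pathWeight (measurable_coinRatio hf') t)
        rw [lintegral_mul_const _ hsum,
          lintegral_add_left (π.measurable_pathWeight (measurable_coinRatio hf) t),
          hmass hf hf4, hmass hf' hf4']
  by_cases hItop : I = ∞
  · simp [hItop]
  have hfin := ENNReal.toReal_mono
    (ENNReal.add_ne_top.2 ⟨by finiteness, by finiteness⟩) (h34.trans hup)
  rw [ENNReal.toReal_ofReal (by norm_num), ENNReal.toReal_add (by finiteness) (by finiteness),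
    ENNReal.toReal_div, ENNReal.toReal_mul] at hfin
  norm_num at hfin
  have h4 : (1 / 4 : ℝ≥0∞) = ENNReal.ofReal (1 / 4) := by
    rw [ENNReal.ofReal_div_of_pos (by norm_num)]
    norm_num
  rw [h4]
  exact ENNReal.ofReal_le_of_le_toReal (by linarith)


/-! ### Regret for unknown signs -/

variable {d : ℕ}

/-- The arm that is better on a cell with the given sign of `f 1 - f 0`. -/
def bestArm (s : Bool) : Fin 2 := if s then 1 else 0

theorem mul_indicator_le_gap {P : Instance d} {x : Ctx d} {s : Bool} {φ : ℝ} (hφ : 0 ≤ φ)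
    (h : P.payoff 1 x = P.payoff 0 x + (if s then 1 else -1) * φ) (k : Fin 2) :
    ENNReal.ofReal φ * (if k = bestArm s then 0 else 1) ≤
      ENNReal.ofReal (Policy.gap P k x) := by
  have h2 : k = bestArm s ∨ φ ≤ Policy.gap P k x := by
    unfold Policy.gap bestArm
    cases s <;> fin_cases k <;> simp_all
  rcases h2 with h2 | h2
  · simp [h2]
  · split_ifs
    · simp
    · simpa using ENNReal.ofReal_le_ofReal h2

/-- Flipping the `j`-th sign. -/
def flipSign {m : ℕ} (j : Fin m) (σ : Fin m → Bool) : Fin m → Bool := Function.update σ j (!σ j)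

theorem flipSign_involutive {m : ℕ} (j : Fin m) : Function.Involutive (flipSign j) := by
  intro σ
  funext i
  by_cases h : i = j
  · subst h
    simp [flipSign]
  · simp [flipSign, h]

/-- Assouad-type lower bound. The two payoffs differ by `± φ` on each of `m` disjoint cells, with
unknown signs. If the cells are so improbable, compared with `1 / ε ^ 2`, that `T` periods do not
reveal the signs, then for some choice of the signs a constant proportion of the visits to the cells
is spent on the worse arm. -/
theorem exists_regret_ge (π : Policy.{u} d) {PX : Measure (Ctx d)}
    (hprob : IsProbabilityMeasure PX) (hcube : PX (cube d)ᶜ = 0) {m : ℕ}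
    {f : (Fin m → Bool) → Fin 2 → Ctx d → ℝ} (hf : ∀ σ k, Measurable (f σ k))
    (hf4 : ∀ σ k x, f σ k x ∈ Set.Icc (1 / 4 : ℝ) (3 / 4))
    (hf01 : ∀ σ k x, f σ k x ∈ Set.Icc (0 : ℝ) 1)
    {A : Fin m → Set (Ctx d)} (hA : ∀ j, MeasurableSet (A j))
    (hdisj : Pairwise (Function.onFun Disjoint A)) {φ : Ctx d → ℝ} (hφm : Measurable φ) {ε w I : ℝ}
    (hφ0 : ∀ x, 0 ≤ φ x) (hφε : ∀ x, φ x ≤ ε)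
    (h0 : ∀ σ σ', f σ 0 = f σ' 0)
    (hon : ∀ σ j, ∀ x ∈ A j, f σ 1 x = f σ 0 x + (if σ j then 1 else -1) * φ x)
    (hoff : ∀ σ, ∀ x, (∀ j, x ∉ A j) → f σ 1 x = f σ 0 x)
    (hw : ∀ j, PX.real (A j) ≤ w)
    (hφI : ∀ j, ENNReal.ofReal I ≤ ∫⁻ x in A j, ENNReal.ofReal (φ x) ∂PX)
    {T : ℕ} (hT : T * ((2 * ε) ^ 2 * w) ≤ 1 / 4) :
    ∃ σ, T * m * I / 8 ≤ π.regret (bernoulliInstance PX hprob hcube (f σ) (hf σ) (hf01 σ)) T := by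
  classical
  set P : (Fin m → Bool) → Instance d := fun σ =>
    bernoulliInstance PX hprob hcube (f σ) (hf σ) (hf01 σ) with hP
  set Q := coinInstance PX hprob hcube with hQ
  have hregret : ∀ σ, 0 ≤ π.regret (P σ) T := fun σ =>
    integral_nonneg fun h => Finset.sum_nonneg fun t _ => Policy.gap_nonneg (P σ) _ _
  -- the expected loss on the cell `j` in the current period, given the past, if its sign is `s`
  let e : (t : ℕ) → Fin m → Bool → π.Hist t → ℝ≥0∞ := fun t j s h =>
    ∫⁻ x in A j, ENNReal.ofReal (φ x) * (if π.choice t (h, x) = bestArm s then 0 else 1) ∂PX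
  have hint : ∀ t s, Measurable fun w : π.Hist t × Ctx d =>
      ENNReal.ofReal (φ w.2) * (if π.choice t w = bestArm s then 0 else 1 : ℝ≥0∞) := fun t s =>
    (hφm.comp measurable_snd).ennreal_ofReal.mul
      (Measurable.ite (π.measurable_choice t (measurableSet_singleton _)) measurable_const
        measurable_const)
  have he : ∀ t j s, Measurable (e t j s) := fun t j s =>
    Measurable.lintegral_prod_right' (ν := PX.restrict (A j)) (hint t s)
  have hesum : ∀ t j s h, ENNReal.ofReal I ≤ e t j s h + e t j (!s) h := fun t j s h => by
    refine (hφI j).trans ?_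
    simp only [e]
    have hms : Measurable fun x => ENNReal.ofReal (φ x) *
        (if π.choice t (h, x) = bestArm s then 0 else 1 : ℝ≥0∞) :=
      (hint t s).comp measurable_prodMk_left
    rw [← lintegral_add_left hms]
    refine lintegral_mono fun x => ?_
    have h2 : ∀ k : Fin 2, (if k = bestArm s then 0 else 1 : ℝ≥0∞) +
        (if k = bestArm (!s) then 0 else 1 : ℝ≥0∞) = 1 := fun k => by
      cases s <;> fin_cases k <;> simp [bestArm]
    change _ ≤ _ * _ + _ * _
    rw [← mul_add, h2, mul_one]
  let Z : (t : ℕ) → (Fin m → Bool) → π.Hist t → ℝ≥0∞ := fun t σ =>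
    π.pathWeight (coinRatio (f σ)) t
  have hZ : ∀ t σ, Measurable (Z t σ) := fun t σ =>
    π.measurable_pathWeight (measurable_coinRatio (hf σ)) t
  have hZe : ∀ t σ j s, Measurable fun h => Z t σ h * e t j s h := fun t σ j s =>
    (hZ t σ).mul (he t j s)
  have hgapm : ∀ t σ, Measurable fun w : π.Hist t × Ctx d =>
      ENNReal.ofReal (Policy.gap (P σ) (π.choice t w) w.2) := fun t σ =>
    ((Policy.measurable_gap (P σ)).comp (g := fun z : Fin 2 × Ctx d => Policy.gap (P σ) z.1 z.2)
      (f := fun w : π.Hist t × Ctx d => (π.choice t w, w.2))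
      ((π.measurable_choice t).prodMk measurable_snd)).ennreal_ofReal
  -- the regret of one period dominates the losses on the cells
  have hperiod : ∀ t σ, ∑ j, ∫⁻ h, Z t σ h * e t j (σ j) h ∂(π.law Q t) ≤
      ∫⁻ h, ∫⁻ x, ENNReal.ofReal (Policy.gap (P σ) (π.choice t (h, x)) x) ∂PX
        ∂(π.law (P σ) t) := fun t σ => by
    have hG : Measurable fun h : π.Hist t =>
        ∫⁻ x, ENNReal.ofReal (Policy.gap (P σ) (π.choice t (h, x)) x) ∂PX :=
      Measurable.lintegral_prod_right' (ν := PX) (hgapm t σ)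
    rw [lintegral_law_bernoulliInstance π hprob hcube (hf σ) (hf01 σ) t hG,
      ← lintegral_finsetSum _ fun j _ => hZe t σ j (σ j)]
    refine lintegral_mono fun h => ?_
    rw [← Finset.mul_sum]
    refine mul_le_mul_right ?_ _
    calc ∑ j, e t j (σ j) h
        ≤ ∑ j, ∫⁻ x in A j, ENNReal.ofReal (Policy.gap (P σ) (π.choice t (h, x)) x) ∂PX := by
          refine Finset.sum_le_sum fun j _ => setLIntegral_mono' (hA j) fun x hx => ?_
          refine mul_indicator_le_gap (hφ0 x) ?_ _
          rw [hP, bernoulliInstance_payoff, bernoulliInstance_payoff]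
          exact hon σ j x hx
      _ = ∫⁻ x in ⋃ j ∈ (Finset.univ : Finset (Fin m)), A j,
            ENNReal.ofReal (Policy.gap (P σ) (π.choice t (h, x)) x) ∂PX :=
          (lintegral_biUnion_finset (fun i _ j _ hij => hdisj hij) (fun j _ => hA j) _).symm
      _ ≤ _ := setLIntegral_le_lintegral _ _
  -- two sign vectors that differ at `j` only cannot be told apart
  have hpair : ∀ t ≤ T, ∀ j σ, ENNReal.ofReal (I / 4) ≤
      ∫⁻ h, Z t σ h * e t j (σ j) h ∂(π.law Q t) +
        ∫⁻ h, Z t (flipSign j σ) h * e t j (flipSign j σ j) h ∂(π.law Q t) := fun t ht j σ => by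
    have hw0 : 0 ≤ w := measureReal_nonneg.trans (hw j)
    have hflip : ∀ i, i ≠ j → flipSign j σ i = σ i := fun i hi => by simp [flipSign, hi]
    have hflipj : flipSign j σ j = !σ j := by simp [flipSign]
    have hmin := quarter_le_lintegral_min π hprob hcube (hf σ) (hf (flipSign j σ)) (hf4 σ)
      (hf4 (flipSign j σ)) (hA j) (δ := 2 * ε) (hw j)
      (fun k x hx => by
        fin_cases k
        · exact congrFun (h0 σ _) x
        · change f σ 1 x = f (flipSign j σ) 1 x
          by_cases hex : ∃ i, x ∈ A i
          · obtain ⟨i, hi⟩ := hex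
            have hij : i ≠ j := fun h => hx (h ▸ hi)
            rw [hon σ i x hi, hon _ i x hi, hflip i hij, h0 σ (flipSign j σ)]
          · rw [hoff σ x (fun i hi => hex ⟨i, hi⟩), hoff _ x (fun i hi => hex ⟨i, hi⟩),
              h0 σ (flipSign j σ)])
      (fun k x hx => by
        have hε0 := (hφ0 x).trans (hφε x)
        fin_cases k
        · change |f σ 0 x - f (flipSign j σ) 0 x| ≤ _
          rw [h0 σ (flipSign j σ), sub_self, abs_zero]
          linarith
        · change |f σ 1 x - f (flipSign j σ) 1 x| ≤ _
          rw [hon σ j x hx, hon _ j x hx, hflipj, h0 σ (flipSign j σ), abs_le]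
          have h1 := hφε x
          have h2 := hφ0 x
          cases σ j <;> constructor <;> simp <;> linarith)
      (t := t) (le_trans (by gcongr) hT)
    have h4 : ENNReal.ofReal (I / 4) = 1 / 4 * ENNReal.ofReal I := by
      rw [div_eq_mul_inv, mul_comm, ENNReal.ofReal_mul (by norm_num),
        ENNReal.ofReal_inv_of_pos (by norm_num)]
      norm_num
    rw [h4, ← lintegral_add_left (hZe t σ j (σ j))]
    refine (mul_le_mul_left hmin _).trans ?_
    rw [← lintegral_mul_const _ ((hZ t σ).min (hZ t (flipSign j σ)))]
    refine lintegral_mono fun h => ?_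
    rw [hflipj]
    calc _ ≤ min (Z t σ h) (Z t (flipSign j σ) h) * (e t j (σ j) h + e t j (!σ j) h) :=
          mul_le_mul_right (hesum t j (σ j) h) _
      _ ≤ _ := by
          rw [mul_add]
          exact add_le_add (mul_le_mul_left (min_le_left _ _) _)
            (mul_le_mul_left (min_le_right _ _) _)
  have hcard : (Finset.univ : Finset (Fin m → Bool)).card = 2 ^ m := by simp
  -- averaging over all sign vectors
  have hcell : ∀ t ≤ T, ∀ j, ENNReal.ofReal (2 ^ m * (I / 8)) ≤
      ∑ σ, ∫⁻ h, Z t σ h * e t j (σ j) h ∂(π.law Q t) := fun t ht j => by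
    have h2 : 2 * ENNReal.ofReal (2 ^ m * (I / 8)) ≤
        2 * ∑ σ, ∫⁻ h, Z t σ h * e t j (σ j) h ∂(π.law Q t) := by
      calc 2 * ENNReal.ofReal (2 ^ m * (I / 8))
          = ∑ _σ : Fin m → Bool, ENNReal.ofReal (I / 4) := by
            rw [Finset.sum_const, hcard, nsmul_eq_mul, ENNReal.ofReal_mul (by positivity),
              ← mul_assoc, mul_comm 2, mul_assoc]
            congr 1
            · rw [ENNReal.ofReal_pow (by norm_num)]
              norm_num
            · rw [show (2 : ℝ≥0∞) = ENNReal.ofReal 2 by norm_num,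
                ← ENNReal.ofReal_mul (by norm_num)]
              congr 1
              ring
        _ ≤ ∑ σ, (∫⁻ h, Z t σ h * e t j (σ j) h ∂(π.law Q t) +
              ∫⁻ h, Z t (flipSign j σ) h * e t j (flipSign j σ j) h ∂(π.law Q t)) :=
            Finset.sum_le_sum fun σ _ => hpair t ht j σ
        _ = _ := by
            rw [Finset.sum_add_distrib, two_mul]
            congr 1
            exact Equiv.sum_comp (flipSign_involutive j).toPerm
              (fun σ => ∫⁻ h, Z t σ h * e t j (σ j) h ∂(π.law Q t))
    exact (ENNReal.mul_le_mul_iff_right (by norm_num) (by norm_num)).1 h2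
  have htotal : ENNReal.ofReal (2 ^ m * (T * m * I / 8)) ≤
      ENNReal.ofReal (∑ σ, π.regret (P σ) T) := by
    rw [ENNReal.ofReal_sum_of_nonneg fun σ _ => hregret σ]
    calc ENNReal.ofReal (2 ^ m * (T * m * I / 8))
        = ∑ _t ∈ Finset.range T, ∑ _j : Fin m, ENNReal.ofReal (2 ^ m * (I / 8)) := by
          simp only [Finset.sum_const, Finset.card_range, Finset.card_univ, Fintype.card_fin,
            nsmul_eq_mul]
          rw [← ENNReal.ofReal_natCast, ← ENNReal.ofReal_natCast,
            ← ENNReal.ofReal_mul (by positivity), ← ENNReal.ofReal_mul (by positivity)]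
          congr 1
          ring
      _ ≤ ∑ t ∈ Finset.range T, ∑ j, ∑ σ, ∫⁻ h, Z t σ h * e t j (σ j) h ∂(π.law Q t) :=
          Finset.sum_le_sum fun t ht => Finset.sum_le_sum fun j _ =>
            hcell t (Finset.mem_range.1 ht).le j
      _ = ∑ t ∈ Finset.range T, ∑ σ, ∑ j, ∫⁻ h, Z t σ h * e t j (σ j) h ∂(π.law Q t) :=
          Finset.sum_congr rfl fun t _ => Finset.sum_comm
      _ ≤ ∑ t ∈ Finset.range T, ∑ σ,
            ∫⁻ h, ∫⁻ x, ENNReal.ofReal (Policy.gap (P σ) (π.choice t (h, x)) x) ∂PX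
              ∂(π.law (P σ) t) :=
          Finset.sum_le_sum fun t _ => Finset.sum_le_sum fun σ _ => hperiod t σ
      _ = ∑ σ, ENNReal.ofReal (π.regret (P σ) T) := by
          rw [Finset.sum_comm]
          exact Finset.sum_congr rfl fun σ _ => (π.ofReal_regret (P σ) T).symm
  have hreal : 2 ^ m * (T * m * I / 8) ≤ ∑ σ, π.regret (P σ) T :=
    (ENNReal.ofReal_le_ofReal_iff (Finset.sum_nonneg fun σ _ => hregret σ)).1 htotal
  obtain ⟨σ, -, hσ⟩ := Finset.exists_le_of_sum_le (s := (Finset.univ : Finset (Fin m → Bool)))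
    (f := fun _ => (T * m * I / 8 : ℝ)) (g := fun σ => π.regret (P σ) T) Finset.univ_nonempty (by
      rw [Finset.sum_const, hcard, nsmul_eq_mul]
      exact_mod_cast hreal)
  exact ⟨σ, hσ⟩


/-! ### Functions with a Hölder continuous top derivative -/

/-- `F` is `n` times continuously differentiable on the whole space, and its `n`-th derivative is
Hölder continuous with exponent `γ` and constant `M`. -/
def HolderDeriv {E : Type*} [NormedAddCommGroup E] [NormedSpace ℝ E] (n : ℕ) (γ M : ℝ)
    (F : E → ℝ) : Prop :=
  ContDiff ℝ n F ∧ ∀ x y, ‖iteratedFDeriv ℝ n F x - iteratedFDeriv ℝ n F y‖ ≤ M * ‖x - y‖ ^ γ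

namespace HolderDeriv

variable {E E' : Type*} [NormedAddCommGroup E] [NormedSpace ℝ E] [NormedAddCommGroup E']
  [NormedSpace ℝ E'] {n : ℕ} {γ M : ℝ} {F : E → ℝ}

theorem mono {M' : ℝ} (hF : HolderDeriv n γ M F) (h : M ≤ M') : HolderDeriv n γ M' F :=
  ⟨hF.1, fun x y => (hF.2 x y).trans (by gcongr)⟩

theorem add {G : E → ℝ} {M' : ℝ} (hF : HolderDeriv n γ M F) (hG : HolderDeriv n γ M' G) :
    HolderDeriv n γ (M + M') (fun x => F x + G x) := by
  refine ⟨hF.1.add hG.1, fun x y => ?_⟩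
  have h : ∀ x, iteratedFDeriv ℝ n (fun x => F x + G x) x =
      iteratedFDeriv ℝ n F x + iteratedFDeriv ℝ n G x := fun x =>
    iteratedFDeriv_add_apply hF.1.contDiffAt hG.1.contDiffAt
  rw [h, h, add_sub_add_comm, add_mul]
  exact (norm_add_le _ _).trans (add_le_add (hF.2 x y) (hG.2 x y))

theorem const_mul (hF : HolderDeriv n γ M F) (c : ℝ) :
    HolderDeriv n γ (|c| * M) (fun x => c * F x) := by
  refine ⟨contDiff_const.mul hF.1, fun x y => ?_⟩
  have h : ∀ x, iteratedFDeriv ℝ n (fun x => c * F x) x = c • iteratedFDeriv ℝ n F x := fun x =>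
    iteratedFDeriv_const_smul_apply (a := c) hF.1.contDiffAt
  rw [h, h, ← smul_sub, norm_smul, Real.norm_eq_abs, mul_assoc]
  exact mul_le_mul_of_nonneg_left (hF.2 x y) (abs_nonneg c)

theorem const (c : ℝ) : HolderDeriv n γ 0 (fun _ : E => c) := by
  refine ⟨contDiff_const, fun x y => ?_⟩
  rcases n with _ | n
  · simp [iteratedFDeriv_zero_eq_comp]
  · simp [iteratedFDeriv_succ_const]

theorem comp_add (hF : HolderDeriv n γ M F) (a : E) :
    HolderDeriv n γ M (fun x => F (x + a)) := by
  refine ⟨hF.1.comp (contDiff_id.add contDiff_const), fun x y => ?_⟩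
  rw [iteratedFDeriv_comp_add_right, iteratedFDeriv_comp_add_right]
  simpa using hF.2 (x + a) (y + a)

theorem comp_clm (hF : HolderDeriv n γ M F) (hM : 0 ≤ M) (hγ : 0 ≤ γ) (ℓ : E' →L[ℝ] E) :
    HolderDeriv n γ (M * ‖ℓ‖ ^ (n + γ)) (fun x => F (ℓ x)) := by
  refine ⟨hF.1.comp ℓ.contDiff, fun x y => ?_⟩
  have h : ∀ x, iteratedFDeriv ℝ n (fun x => F (ℓ x)) x =
      (iteratedFDeriv ℝ n F (ℓ x)).compContinuousLinearMap fun _ => ℓ := fun x =>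
    ℓ.iteratedFDeriv_comp_right hF.1 x le_rfl
  have hsub : ∀ A B : E [×n]→L[ℝ] ℝ, A.compContinuousLinearMap (fun _ => ℓ) -
      B.compContinuousLinearMap (fun _ => ℓ) = (A - B).compContinuousLinearMap fun _ => ℓ :=
    fun A B => by ext; simp
  rw [h, h, hsub]
  refine (ContinuousMultilinearMap.norm_compContinuousLinearMap_le _ _).trans ?_
  rw [Finset.prod_const, Finset.card_univ, Fintype.card_fin]
  have h1 : ‖ℓ x - ℓ y‖ ≤ ‖ℓ‖ * ‖x - y‖ := by
    rw [← map_sub]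
    exact ℓ.le_opNorm _
  calc _ ≤ (M * (‖ℓ‖ * ‖x - y‖) ^ γ) * ‖ℓ‖ ^ n := by
        refine mul_le_mul_of_nonneg_right ((hF.2 _ _).trans ?_) (by positivity)
        gcongr
    _ = M * ‖ℓ‖ ^ (n + γ) * ‖x - y‖ ^ γ := by
        rw [Real.mul_rpow (norm_nonneg _) (norm_nonneg _)]
        rcases eq_or_ne (n + γ) 0 with h0 | h0
        · have hn : (n : ℝ) = 0 := by
            have : (0 : ℝ) ≤ n := n.cast_nonneg
            linarith
          have hγ0 : γ = 0 := by linarith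
          have hn' : n = 0 := by exact_mod_cast hn
          simp [hγ0, hn']
        · rw [Real.rpow_add' (norm_nonneg _) h0, Real.rpow_natCast]
          ring

/-- A sum of functions with pairwise disjoint supports has, up to a factor `2`, the Hölder constant
of its terms: at two given points at most two terms are nonzero. -/
theorem sum_of_disjoint {ι : Type*} [Fintype ι] {F : ι → E → ℝ} {A : ι → Set E}
    (hF : ∀ j, HolderDeriv n γ M (F j)) (hM : 0 ≤ M)
    (hsupp : ∀ j, ∀ x ∉ A j, iteratedFDeriv ℝ n (F j) x = 0)
    (hA : Pairwise (Function.onFun Disjoint A)) :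
    HolderDeriv n γ (2 * M) (fun x => ∑ j, F j x) := by
  classical
  refine ⟨ContDiff.sum fun j _ => (hF j).1, fun x y => ?_⟩
  have h : ∀ x, iteratedFDeriv ℝ n (fun x => ∑ j, F j x) x = ∑ j, iteratedFDeriv ℝ n (F j) x :=
    fun x => by
      rw [← iteratedFDeriv_sum_apply fun j _ => (hF j).1.contDiffAt]
      congr 1
      funext z
      simp
  have hone : ∀ x, ∃ s : Finset ι, s.card ≤ 1 ∧ ∀ j ∉ s, x ∉ A j := fun x => by
    by_cases hx : ∃ i, x ∈ A i
    · obtain ⟨i, hi⟩ := hx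
      refine ⟨{i}, by simp, fun j hj hxj => ?_⟩
      exact Set.disjoint_left.1 (hA (fun hji => hj (by simp [hji]))) hxj hi
    · exact ⟨∅, by simp, fun j _ hj => hx ⟨j, hj⟩⟩
  obtain ⟨s, hs, hs'⟩ := hone x
  obtain ⟨t, ht, ht'⟩ := hone y
  have hr : 0 ≤ M * ‖x - y‖ ^ γ := by positivity
  rw [h, h, ← Finset.sum_sub_distrib,
    ← Finset.sum_subset (Finset.subset_univ (s ∪ t)) fun j _ hj => by
    rw [hsupp j x (hs' j fun h => hj (Finset.mem_union_left _ h)),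
      hsupp j y (ht' j fun h => hj (Finset.mem_union_right _ h)), sub_self]]
  refine (norm_sum_le _ _).trans ((Finset.sum_le_card_nsmul _ _ _ fun j _ => (hF j).2 x y).trans ?_)
  rw [nsmul_eq_mul, mul_assoc]
  refine mul_le_mul_of_nonneg_right ?_ hr
  have := Finset.card_union_le s t
  exact_mod_cast (by omega : (s ∪ t).card ≤ 2)

/-- Taylor's theorem along a segment. -/
theorem abs_sub_taylor_le (hF : HolderDeriv n γ M F) (hM : 0 ≤ M) (hγ : 0 ≤ γ) (x v : E) :
    |F (x + v) - ∑ j ∈ Finset.range (n + 1),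
      ((j.factorial : ℝ)⁻¹) * iteratedFDeriv ℝ j F x (fun _ => v)| ≤ M * ‖v‖ ^ (n + γ) := by
  -- the restriction of `F` to the line through `x` with direction `v`
  let ℓ : ℝ →L[ℝ] E := ContinuousLinearMap.toSpanSingleton ℝ v
  let φ : ℝ → ℝ := fun s => F (ℓ s + x)
  have hFx : ContDiff ℝ n (fun z => F (z + x)) := hF.1.comp (contDiff_id.add contDiff_const)
  have hφ : ContDiff ℝ n φ := hFx.comp ℓ.contDiff
  have hder : ∀ j ≤ n, ∀ s, iteratedDeriv j φ s =
      iteratedFDeriv ℝ j F (ℓ s + x) (fun _ => v) := fun j hj s => by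
    have h1 : iteratedFDeriv ℝ j φ s =
        (iteratedFDeriv ℝ j (fun z => F (z + x)) (ℓ s)).compContinuousLinearMap fun _ => ℓ :=
      ℓ.iteratedFDeriv_comp_right hFx s (by exact_mod_cast hj)
    rw [iteratedDeriv_eq_iteratedFDeriv, h1, iteratedFDeriv_comp_add_right]
    simp [ℓ]
  have h0 : ∀ j ≤ n, iteratedDeriv j φ 0 = iteratedFDeriv ℝ j F x (fun _ => v) := fun j hj => by
    simpa using hder j hj 0
  have hφ1 : φ 1 = F (x + v) := by simp [φ, ℓ, add_comm]
  -- the Lagrange remainder of order `n`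
  have hlag : ∃ ξ ∈ Set.Icc (0 : ℝ) 1, φ 1 - ∑ j ∈ Finset.range n,
      ((j.factorial : ℝ)⁻¹) * iteratedDeriv j φ 0 =
        ((n.factorial : ℝ)⁻¹) * iteratedDeriv n φ ξ := by
    rcases n with _ | k
    · exact ⟨1, by simp, by simp⟩
    · obtain ⟨ξ, hξ, h⟩ := taylor_mean_remainder_lagrange_iteratedDeriv (n := k) (f := φ)
        (x₀ := 0) (x := 1) (by norm_num) (by exact_mod_cast hφ.contDiffOn)
      rw [Set.uIoo_of_le zero_le_one] at hξ
      rw [Set.uIcc_of_le zero_le_one] at h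
      refine ⟨ξ, Set.Ioo_subset_Icc_self hξ, ?_⟩
      rw [taylor_within_apply] at h
      have hsum : ∑ j ∈ Finset.range (k + 1), (((j.factorial : ℝ)⁻¹ * (1 - 0) ^ j) •
          iteratedDerivWithin j φ (Set.Icc 0 1) 0) = ∑ j ∈ Finset.range (k + 1),
          ((j.factorial : ℝ)⁻¹) * iteratedDeriv j φ 0 := by
        refine Finset.sum_congr rfl fun j hj => ?_
        rw [iteratedDerivWithin_eq_iteratedDeriv (uniqueDiffOn_Icc zero_lt_one)
          ((hφ.of_le (by exact_mod_cast (Finset.mem_range.1 hj).le)).contDiffAt) (by simp)]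
        simp
      rw [hsum] at h
      rw [h]
      simp [div_eq_inv_mul]
  obtain ⟨ξ, hξ, h⟩ := hlag
  have hsum : ∑ j ∈ Finset.range (n + 1),
      ((j.factorial : ℝ)⁻¹) * iteratedFDeriv ℝ j F x (fun _ => v) =
      ∑ j ∈ Finset.range n, ((j.factorial : ℝ)⁻¹) * iteratedDeriv j φ 0 +
        ((n.factorial : ℝ)⁻¹) * iteratedDeriv n φ 0 := by
    rw [← Finset.sum_range_succ (fun j => ((j.factorial : ℝ)⁻¹) * iteratedDeriv j φ 0)]
    refine Finset.sum_congr rfl fun j hj => ?_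
    rw [h0 j (Nat.lt_succ_iff.1 (Finset.mem_range.1 hj))]
  rw [hsum, ← hφ1, ← sub_sub, h, ← mul_sub, hder n le_rfl, hder n le_rfl,
    ← _root_.sub_apply, abs_mul]
  have hfac : |((n.factorial : ℝ)⁻¹)| ≤ 1 := by
    rw [abs_of_nonneg (by positivity)]
    exact inv_le_one_of_one_le₀ (by exact_mod_cast Nat.one_le_iff_ne_zero.2 n.factorial_ne_zero)
  have hb := (iteratedFDeriv ℝ n F (ℓ ξ + x) - iteratedFDeriv ℝ n F (ℓ 0 + x)).le_opNorm
    (fun _ => v)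
  rw [Finset.prod_const, Finset.card_univ, Fintype.card_fin, Real.norm_eq_abs] at hb
  have hξv : ‖ℓ ξ + x - (ℓ 0 + x)‖ ≤ ‖v‖ := by
    have : ℓ ξ + x - (ℓ 0 + x) = ξ • v := by simp [ℓ]
    rw [this, norm_smul, Real.norm_of_nonneg hξ.1]
    exact mul_le_of_le_one_left (norm_nonneg _) hξ.2
  calc _ ≤ 1 * (M * ‖v‖ ^ γ * ‖v‖ ^ n) := by
        refine mul_le_mul hfac (hb.trans ?_) (abs_nonneg _) zero_le_one
        refine mul_le_mul_of_nonneg_right ((hF.2 _ _).trans ?_) (by positivity)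
        gcongr
    _ = M * ‖v‖ ^ (n + γ) := by
        rcases eq_or_ne (n + γ) 0 with h0 | h0
        · have hn : (n : ℝ) = 0 := by
            have : (0 : ℝ) ≤ n := n.cast_nonneg
            linarith
          have hγ0 : γ = 0 := by linarith
          have hn' : n = 0 := by exact_mod_cast hn
          simp [hγ0, hn']
        · rw [Real.rpow_add' (norm_nonneg _) h0, Real.rpow_natCast]
          ring

theorem holder {d : ℕ} {β : ℝ} {F : Ctx d → ℝ} (hF : HolderDeriv n γ M F) (hM : 0 ≤ M)
    (hγ : 0 ≤ γ) (hn : strictFloor β = n) (hβ : β = n + γ) : Holder β M F := by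
  refine ⟨hn ▸ hF.1.contDiffOn, fun x hx x' hx' => ?_⟩
  have hu : UniqueDiffOn ℝ (cube d) := by
    have : cube d = Set.univ.pi fun _ => Set.Icc (0 : ℝ) 1 := (Set.pi_univ_Icc 0 1).symm
    rw [this]
    exact UniqueDiffOn.univ_pi fun _ => uniqueDiffOn_Icc zero_lt_one
  have ht : taylor F n x x' = ∑ j ∈ Finset.range (n + 1),
      ((j.factorial : ℝ)⁻¹) * iteratedFDeriv ℝ j F x (fun _ => x' - x) := by
    refine Finset.sum_congr rfl fun j hj => ?_
    rw [iteratedFDerivWithin_eq_iteratedFDeriv hu ?_ hx]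
    exact (hF.1.of_le (by exact_mod_cast Nat.lt_succ_iff.1 (Finset.mem_range.1 hj))).contDiffAt
  have h := hF.abs_sub_taylor_le hM hγ x (x' - x)
  rw [hn, ht, hβ, norm_sub_rev]
  simpa using h

end HolderDeriv


/-! ### A bounded function with a power singularity -/

namespace HolderDeriv

theorem of_continuous {E : Type*} [NormedAddCommGroup E] [NormedSpace ℝ E] {γ M : ℝ} {F : E → ℝ}
    (hF : Continuous F) (h : ∀ x y, |F x - F y| ≤ M * ‖x - y‖ ^ γ) : HolderDeriv 0 γ M F := by
  refine ⟨contDiff_zero.2 hF, fun x y => ?_⟩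
  rw [iteratedFDeriv_zero_eq_comp, Function.comp_apply, Function.comp_apply, ← map_sub,
    LinearIsometryEquiv.norm_map]
  exact h x y

theorem of_hasDerivAt {n : ℕ} {γ M : ℝ} {F F' : ℝ → ℝ} (hF : ∀ t, HasDerivAt F (F' t) t)
    (h : HolderDeriv n γ M F') : HolderDeriv (n + 1) γ M F := by
  have hd : deriv F = F' := funext fun t => (hF t).deriv
  refine ⟨?_, fun x y => ?_⟩
  · push_cast
    refine contDiff_succ_iff_deriv.2 ⟨fun t => (hF t).differentiableAt, by simp, ?_⟩
    rw [hd]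
    exact h.1
  · have h2 := h.2 x y
    rw [iteratedFDeriv_eq_equiv_comp, Function.comp_apply, Function.comp_apply, ← map_sub,
      LinearIsometryEquiv.norm_map] at h2 ⊢
    rwa [iteratedDeriv_succ', hd]

end HolderDeriv

/-- The positive part of `t`, to the power `s`. -/
noncomputable def posPow (s t : ℝ) : ℝ := max t 0 ^ s

theorem posPow_of_nonneg (s : ℝ) {t : ℝ} (ht : 0 ≤ t) : posPow s t = t ^ s := by
  rw [posPow, max_eq_left ht]

theorem posPow_of_nonpos {s : ℝ} (hs : s ≠ 0) {t : ℝ} (ht : t ≤ 0) : posPow s t = 0 := by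
  rw [posPow, max_eq_right ht, Real.zero_rpow hs]

theorem posPow_nonneg (s t : ℝ) : 0 ≤ posPow s t := Real.rpow_nonneg (le_max_right _ _) _

theorem hasDerivAt_posPow {s : ℝ} (hs : 0 < s) (t : ℝ) :
    HasDerivAt (posPow (s + 1)) ((s + 1) * posPow s t) t := by
  have hneg : t ≤ 0 → HasDerivWithinAt (posPow (s + 1)) ((s + 1) * posPow s t) (Set.Iic 0) t :=
    fun ht => by
      rw [posPow_of_nonpos hs.ne' ht, mul_zero]
      exact (hasDerivWithinAt_const t _ (0 : ℝ)).congr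
        (fun x hx => posPow_of_nonpos (by positivity) hx) (posPow_of_nonpos (by positivity) ht)
  have hpos : 0 ≤ t → HasDerivWithinAt (posPow (s + 1)) ((s + 1) * posPow s t) (Set.Ici 0) t :=
    fun ht => by
      have h := (Real.hasDerivAt_rpow_const (x := t) (p := s + 1)
        (Or.inr (by linarith))).hasDerivWithinAt (s := Set.Ici 0)
      rw [add_sub_cancel_right] at h
      rw [posPow_of_nonneg s ht]
      exact h.congr (fun x hx => posPow_of_nonneg _ hx) (posPow_of_nonneg _ ht)
  rcases lt_trichotomy t 0 with ht | rfl | ht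
  · exact (hneg ht.le).hasDerivAt (Iic_mem_nhds ht)
  · have h := (hneg le_rfl).union (hpos le_rfl)
    rw [Set.Iic_union_Ici] at h
    exact h.hasDerivAt Filter.univ_mem
  · exact (hpos ht.le).hasDerivAt (Ici_mem_nhds ht)

theorem abs_posPow_sub_le {γ : ℝ} (h0 : 0 < γ) (h1 : γ ≤ 1) (x y : ℝ) :
    |posPow γ x - posPow γ y| ≤ |x - y| ^ γ := by
  have key : ∀ {x y : ℝ}, y ≤ x → posPow γ x - posPow γ y ≤ |x - y| ^ γ := fun {x y} hxy => by
    have h := Real.rpow_add_le_add_rpow (le_max_right y 0)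
      (sub_nonneg.2 (max_le_max_right 0 hxy)) h0.le h1
    rw [add_sub_cancel] at h
    have h2 : max x 0 - max y 0 ≤ |x - y| := (le_abs_self _).trans (abs_max_sub_max_le_abs x y 0)
    have h3 := Real.rpow_le_rpow (sub_nonneg.2 (max_le_max_right 0 hxy)) h2 h0.le
    unfold posPow
    linarith
  have mono : ∀ {x y : ℝ}, y ≤ x → posPow γ y ≤ posPow γ x := fun {x y} hxy =>
    Real.rpow_le_rpow (le_max_right _ _) (max_le_max_right 0 hxy) h0.le
  rcases le_total y x with h | h
  · rw [abs_of_nonneg (sub_nonneg.2 (mono h))]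
    exact key h
  · rw [abs_sub_comm, abs_sub_comm x y, abs_of_nonneg (sub_nonneg.2 (mono h))]
    exact key h

theorem continuous_posPow {s : ℝ} (hs : 0 ≤ s) : Continuous (posPow s) :=
  (continuous_id.max continuous_const).rpow_const fun _ => Or.inr hs

theorem exists_holderDeriv_posPow {γ : ℝ} (h0 : 0 < γ) (h1 : γ ≤ 1) (n : ℕ) :
    ∃ M, 0 ≤ M ∧ HolderDeriv n γ M (posPow (n + γ)) := by
  induction n with
  | zero =>
    refine ⟨1, zero_le_one, ?_⟩
    simp only [Nat.cast_zero, zero_add]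
    exact HolderDeriv.of_continuous (continuous_posPow h0.le) fun x y => by
      simpa using abs_posPow_sub_le h0 h1 x y
  | succ n ih =>
    obtain ⟨M, hM, h⟩ := ih
    have hpos : 0 < (n : ℝ) + γ := by positivity
    refine ⟨|(n : ℝ) + γ + 1| * M, by positivity, ?_⟩
    have he : ((n + 1 : ℕ) : ℝ) + γ = n + γ + 1 := by
      push_cast
      ring
    rw [he]
    exact HolderDeriv.of_hasDerivAt (hasDerivAt_posPow hpos) (h.const_mul _)

/-- The backward difference with step `1`. -/
def backDiff (F : ℝ → ℝ) (t : ℝ) : ℝ := F t - F (t - 1)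

theorem holderDeriv_backDiff_iterate {n : ℕ} {γ M : ℝ} {F : ℝ → ℝ} (h : HolderDeriv n γ M F)
    (k : ℕ) : HolderDeriv n γ (2 ^ k * M) (backDiff^[k] F) := by
  induction k with
  | zero => simpa using h
  | succ k ih =>
    rw [Function.iterate_succ_apply', pow_succ]
    have := ih.add ((ih.comp_add (-1)).const_mul (-1))
    have he : (backDiff (backDiff^[k] F)) =
        fun x => backDiff^[k] F x + -1 * backDiff^[k] F (x + -1) := by
      funext x
      rw [backDiff, sub_eq_add_neg x 1]
      ring
    rw [he]
    refine this.mono (le_of_eq ?_)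
    rw [abs_neg, abs_one]
    ring

theorem backDiff_iterate_eq {F : ℝ → ℝ} (hF : ∀ t ≤ 0, F t = 0) (k : ℕ) {t : ℝ} (ht : t ≤ 1) :
    backDiff^[k] F t = F t := by
  induction k generalizing t with
  | zero => rfl
  | succ k ih =>
    rw [Function.iterate_succ_apply', backDiff, ih ht, ih (by linarith : t - 1 ≤ 1),
      hF _ (by linarith : t - 1 ≤ 0), sub_zero]

theorem hasDerivAt_backDiff_iterate {F F' : ℝ → ℝ} (hF : ∀ t, HasDerivAt F (F' t) t) (k : ℕ)
    (t : ℝ) : HasDerivAt (backDiff^[k] F) (backDiff^[k] F' t) t := by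
  induction k generalizing t with
  | zero => exact hF t
  | succ k ih =>
    simp only [Function.iterate_succ_apply']
    exact (ih t).sub ((ih (t - 1)).comp_sub_const t 1)

theorem backDiff_iterate_const_mul (c : ℝ) (F : ℝ → ℝ) (k : ℕ) :
    backDiff^[k] (fun t => c * F t) = fun t => c * backDiff^[k] F t := by
  induction k with
  | zero => rfl
  | succ k ih =>
    rw [Function.iterate_succ_apply', ih, Function.iterate_succ_apply']
    funext t
    simp only [backDiff]
    ring

/-- Each backward difference of a power lowers its growth by one order. -/
theorem exists_bound_backDiff_posPow {γ : ℝ} (h0 : 0 < γ) (h1 : γ ≤ 1) (n : ℕ) :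
    ∃ B, 0 ≤ B ∧ ∀ t, |backDiff^[n + 1] (posPow (n + γ)) t| ≤ B := by
  induction n with
  | zero =>
    refine ⟨1, zero_le_one, fun t => ?_⟩
    simpa [backDiff] using abs_posPow_sub_le h0 h1 t (t - 1)
  | succ n ih =>
    obtain ⟨B, hB, h⟩ := ih
    have hpos : 0 < (n : ℝ) + γ := by positivity
    refine ⟨|(n : ℝ) + γ + 1| * B, by positivity, fun t => ?_⟩
    have he : ((n + 1 : ℕ) : ℝ) + γ = n + γ + 1 := by
      push_cast
      ring
    rw [he, Function.iterate_succ_apply', backDiff]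
    have hd := hasDerivAt_backDiff_iterate (hasDerivAt_posPow hpos) (n + 1)
    have := Convex.norm_image_sub_le_of_norm_hasDerivWithin_le
      (f := backDiff^[n + 1] (posPow (n + γ + 1))) (s := Set.univ) (x := t - 1) (y := t)
      (C := |(n : ℝ) + γ + 1| * B) (fun x _ => (hd x).hasDerivWithinAt)
      (fun x _ => by
        rw [backDiff_iterate_const_mul, norm_mul, Real.norm_eq_abs, Real.norm_eq_abs]
        exact mul_le_mul_of_nonneg_left (h x) (abs_nonneg _)) convex_univ trivial trivial
    simpa using this

/-- A bounded function on the line, equal to `t ^ β` on `[0, 1]`, whose `n`-th derivative is Hölder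
continuous with exponent `γ`, where `β = n + γ`. -/
theorem exists_rough_profile {γ : ℝ} (h0 : 0 < γ) (h1 : γ ≤ 1) (n : ℕ) :
    ∃ (G : ℝ → ℝ) (M B : ℝ), 0 < M ∧ 0 < B ∧ HolderDeriv n γ M G ∧ (∀ t, |G t| ≤ B) ∧
      ∀ t, 0 ≤ t → t ≤ 1 → G t = t ^ (n + γ) := by
  obtain ⟨M, hM, h⟩ := exists_holderDeriv_posPow h0 h1 n
  obtain ⟨B, hB, hb⟩ := exists_bound_backDiff_posPow h0 h1 n
  have hpos : 0 < (n : ℝ) + γ := by positivity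
  refine ⟨backDiff^[n + 1] (posPow (n + γ)), 2 ^ (n + 1) * M + 1, B + 1, by positivity,
    by positivity, (holderDeriv_backDiff_iterate h (n + 1)).mono (by linarith),
    fun t => (hb t).trans (by linarith), fun t ht0 ht1 => ?_⟩
  rw [backDiff_iterate_eq (fun t ht => posPow_of_nonpos hpos.ne' ht) _ ht1,
    posPow_of_nonneg _ ht0]

/-! ### Polynomials do not approximate a power singularity -/

/-- The product over `i < k` of the operators `f ↦ f (· / 2) - 2⁻ⁱ f`. It annihilates the
polynomials of degree less than `k`, and multiplies a power by a scalar. -/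
noncomputable def dyadicOp : ℕ → (ℝ → ℝ) →ₗ[ℝ] (ℝ → ℝ)
  | 0 => LinearMap.id
  | k + 1 => (LinearMap.funLeft ℝ ℝ (fun t : ℝ => t / 2) - ((2 : ℝ) ^ k)⁻¹ • LinearMap.id) ∘ₗ
      dyadicOp k

theorem dyadicOp_succ_apply (k : ℕ) (f : ℝ → ℝ) (t : ℝ) :
    dyadicOp (k + 1) f t = dyadicOp k f (t / 2) - ((2 : ℝ) ^ k)⁻¹ * dyadicOp k f t := rfl

theorem abs_dyadicOp_le {f : ℝ → ℝ} {h ε : ℝ} (hf : ∀ t, 0 ≤ t → t ≤ h → |f t| ≤ ε) (k : ℕ)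
    {t : ℝ} (h0 : 0 ≤ t) (h1 : t ≤ h) : |dyadicOp k f t| ≤ 2 ^ k * ε := by
  induction k generalizing t with
  | zero => simpa [dyadicOp] using hf t h0 h1
  | succ k ih =>
    have i1 := ih h0 h1
    have i2 := ih (t := t / 2) (by linarith) (by linarith)
    have h2 : ((2 : ℝ) ^ k)⁻¹ ≤ 1 := inv_le_one_of_one_le₀ (one_le_pow₀ (by norm_num))
    rw [dyadicOp_succ_apply, pow_succ]
    refine (abs_sub _ _).trans ?_
    rw [abs_mul, abs_of_nonneg (by positivity : (0 : ℝ) ≤ ((2 : ℝ) ^ k)⁻¹)]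
    nlinarith [mul_le_of_le_one_left (abs_nonneg (dyadicOp k f t)) h2]

theorem dyadicOp_homogeneous {f : ℝ → ℝ} {r : ℝ}
    (hf : ∀ t, 0 ≤ t → f (t / 2) = r * f t) (k : ℕ) {t : ℝ} (h0 : 0 ≤ t) :
    dyadicOp k f t = (∏ i ∈ Finset.range k, (r - ((2 : ℝ) ^ i)⁻¹)) * f t := by
  induction k generalizing t with
  | zero => simp [dyadicOp]
  | succ k ih =>
    rw [dyadicOp_succ_apply, ih h0, ih (t := t / 2) (by linarith), hf t h0,
      Finset.prod_range_succ]
    ring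

theorem dyadicOp_polynomial {P : Polynomial ℝ} {k : ℕ} (hP : P.natDegree < k) {t : ℝ}
    (h0 : 0 ≤ t) : dyadicOp k (fun s => P.eval s) t = 0 := by
  have he : (fun s => P.eval s) =
      ∑ i ∈ Finset.range k, P.coeff i • fun s : ℝ => s ^ i := by
    funext s
    rw [Polynomial.eval_eq_sum_range' hP]
    simp
  rw [he, map_sum, Finset.sum_apply]
  refine Finset.sum_eq_zero fun i hi => ?_
  rw [map_smul, Pi.smul_apply, dyadicOp_homogeneous (r := ((2 : ℝ) ^ i)⁻¹)
    (fun s _ => by rw [div_pow, div_eq_inv_mul]) k h0, Finset.prod_eq_zero hi (sub_self _)]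
  simp

/-- A lower bound for the distance, on `[0, 1]`, between `t ^ β` and the polynomials of degree at
most `p`. -/
noncomputable def powGap (β : ℝ) (p : ℕ) : ℝ :=
  |∏ i ∈ Finset.range (p + 1), ((2 : ℝ) ^ (-β) - ((2 : ℝ) ^ i)⁻¹)| / 2 ^ (p + 1)

theorem powGap_pos {β : ℝ} (hβ : ∀ n : ℤ, β ≠ n) (p : ℕ) : 0 < powGap β p := by
  refine div_pos (abs_pos.2 (Finset.prod_ne_zero_iff.2 fun i _ h => ?_)) (by positivity)
  rw [sub_eq_zero, ← Real.rpow_natCast, ← Real.rpow_neg (by norm_num)] at h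
  have := (Real.strictMono_rpow_of_base_gt_one (b := 2) (by norm_num)).injective h
  exact hβ i (by simpa using this)

theorem powGap_le_of_abs_sub_le {β c h ε : ℝ} (hc : 0 ≤ c) (hh : 0 ≤ h)
    {p : ℕ} {P : Polynomial ℝ} (hP : P.natDegree ≤ p)
    (hε : ∀ t, 0 ≤ t → t ≤ h → |P.eval t - c * t ^ β| ≤ ε) : c * h ^ β * powGap β p ≤ ε := by
  have h1 := abs_dyadicOp_le (f := (fun t => P.eval t) - fun t => c * t ^ β) hε (p + 1) hh le_rfl
  rw [map_sub, Pi.sub_apply, dyadicOp_polynomial (Nat.lt_succ_of_le hP) hh,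
    dyadicOp_homogeneous (r := (2 : ℝ) ^ (-β)) (fun t ht => by
      rw [Real.div_rpow ht (by norm_num), Real.rpow_neg (by norm_num)]
      ring) _ hh, zero_sub, abs_neg, abs_mul,
    abs_of_nonneg (by positivity : 0 ≤ c * h ^ β)] at h1
  rw [powGap, mul_div_assoc', div_le_iff₀ (by positivity)]
  linarith

/-! ### Self-similarity -/

variable {d : ℕ}

/-- On a cube of side `h`, the box kernel of bandwidth `h` is `1`, so the local projection at every
point of the cube is given by one and the same polynomial. -/
theorem exists_eval_eq_polyProj (PX : Measure (Ctx d)) (f : Ctx d → ℝ) (p : ℕ) {h : ℝ} (hh : 0 < h)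
    {U : Set (Ctx d)} (hUm : MeasurableSet U) (hU : ∀ x ∈ U, ∀ y ∈ U, ‖x - y‖ ≤ h) :
    ∃ g : MvPolynomial (Fin d) ℝ, g.totalDegree ≤ p ∧
      ∀ x ∈ U, polyProj PX f p h U x = MvPolynomial.eval x g := by
  have herr : ∀ x ∈ U, ∀ y ∈ U, ∀ g, sqError PX f h U x g = sqError PX f h U y g :=
    fun x hx y hy g => by
      refine setIntegral_congr_fun hUm fun v hv => ?_
      have hk : ∀ z ∈ U, boxKernel (h⁻¹ • (z - v)) = 1 := fun z hz => by
        rw [boxKernel, if_pos]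
        rw [norm_smul, norm_inv, Real.norm_of_nonneg hh.le, inv_mul_le_iff₀ hh, mul_one]
        exact hU z hz v hv
      simp only [hk x hx, hk y hy]
  have hproj : ∀ x ∈ U, ∀ y ∈ U, IsPolyProj PX f p h U x = IsPolyProj PX f p h U y :=
    fun x hx y hy => by
      funext g
      unfold IsPolyProj
      rw [herr x hx y hy g]
      simp only [herr x hx y hy]
  by_cases hex : ∃ x ∈ U, ∃ g, IsPolyProj PX f p h U x g
  · obtain ⟨x₀, hx₀, H⟩ := hex
    refine ⟨H.choose, H.choose_spec.1, fun x hx => ?_⟩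
    have hH : ∃ g, IsPolyProj PX f p h U x g := by rwa [hproj x hx x₀ hx₀]
    rw [polyProj, dif_pos hH]
    simp only [hproj x hx x₀ hx₀]
  · refine ⟨0, by simp, fun x hx => ?_⟩
    rw [polyProj, dif_neg fun H => hex ⟨x, hx, H⟩, map_zero]

theorem norm_sub_le_of_mem_bin {q l : ℕ} {m : Fin d → Fin (q ^ l)} {x y : Ctx d}
    (hx : x ∈ bin q l m) (hy : y ∈ bin q l m) : ‖x - y‖ ≤ ((q : ℝ) ^ l)⁻¹ := by
  refine (pi_norm_le_iff_of_nonneg (by positivity)).2 fun i => ?_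
  have h1 := hx i
  have h2 := hy i
  rw [add_div, one_div] at h1 h2
  rw [Pi.sub_apply, Real.norm_eq_abs, abs_le]
  constructor <;> linarith

theorem isClosed_bin {q l : ℕ} (m : Fin d → Fin (q ^ l)) : IsClosed (bin q l m) := by
  simp only [bin, Set.ofPred_forall, Set.ofPred_and]
  exact isClosed_iInter fun i =>
    (isClosed_le continuous_const (continuous_apply i)).inter
      (isClosed_le (continuous_apply i) continuous_const)

/-- A payoff function that is a constant plus `c * x_i ^ β` near the face `x_i = 0` makes a problem
self-similar, because of the singularity at that face. -/
theorem selfSimilar_of_eq_pow {PX : Measure (Ctx d)} {f : Fin 2 → Ctx d → ℝ} {β βbar b l₀ c a : ℝ}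
    (hHolder : ∀ k, ∃ L, Holder β L (f k)) (hc : 0 ≤ c) (i : Fin d)
    (hb : b ≤ c * powGap β (strictFloor βbar))
    (hf : ∀ x ∈ cube d, x i ≤ (2 : ℝ) ^ (-l₀) → f 0 x = a + c * x i ^ β)
    (hPX : ∀ r : ℝ, 0 < r → PX (Set.Icc 0 (fun _ => r)) ≠ 0) :
    SelfSimilar PX f β βbar b l₀ := by
  refine ⟨hHolder, fun l q p hl hq _ hp => ?_⟩
  have hq0 : (0 : ℝ) < q := by exact_mod_cast (by omega : 0 < q)
  have hql : 0 < q ^ l := pow_pos (by omega) l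
  set h : ℝ := ((q : ℝ) ^ l)⁻¹ with hh
  have hh0 : 0 < h := by positivity
  have hh1 : h ≤ 1 := inv_le_one_of_one_le₀ (one_le_pow₀ (by exact_mod_cast hq.le))
  have hhl : h ≤ (2 : ℝ) ^ (-l₀) := by
    rw [hh, Real.rpow_neg (by norm_num)]
    refine inv_anti₀ (by positivity) ?_
    calc (2 : ℝ) ^ l₀ ≤ (2 : ℝ) ^ (l : ℝ) := Real.rpow_le_rpow_of_exponent_le (by norm_num) hl
      _ = 2 ^ l := Real.rpow_natCast _ _
      _ ≤ (q : ℝ) ^ l := pow_le_pow_left₀ (by norm_num) (by exact_mod_cast hq) l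
  have hbin : bin q l (fun _ : Fin d => (⟨0, hql⟩ : Fin (q ^ l))) = Set.Icc 0 (fun _ => h) := by
    ext x
    simp only [bin, Nat.cast_zero, zero_div, zero_add, one_div, Set.mem_ofPred_eq, Set.mem_Icc,
      Pi.le_def, Pi.zero_apply, ← hh]
    exact forall_and
  refine ⟨fun _ => ⟨0, hql⟩, by rw [hbin]; exact hPX h hh0, 0, ?_⟩
  set U := bin q l (fun _ : Fin d => (⟨0, hql⟩ : Fin (q ^ l))) with hU
  obtain ⟨g, hgdeg, hg⟩ := exists_eval_eq_polyProj PX (f 0) p hh0 (isClosed_bin _).measurableSet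
    (U := U) fun x hx y hy => norm_sub_le_of_mem_bin hx hy
  -- the restriction of the projection to the edge along the coordinate `i`
  let P : Polynomial ℝ := MvPolynomial.aeval (fun k => if k = i then Polynomial.X else 0) g -
    Polynomial.C a
  have hPdeg : P.natDegree ≤ strictFloor βbar := by
    refine (Polynomial.natDegree_sub_le _ _).trans (max_le ?_ (by simp))
    refine (MvPolynomial.aeval_natDegree_le (m := p) (n := 1) g hgdeg _ fun k => ?_).trans
      (by simpa)
    split_ifs <;> simp
  have hPeval : ∀ t, P.eval t =
      MvPolynomial.eval (fun k => if k = i then t else 0) g - a := fun t => by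
    simp only [P, Polynomial.eval_sub, Polynomial.eval_C]
    congr 1
    rw [← Polynomial.coe_evalRingHom, MvPolynomial.aeval_def, MvPolynomial.eval₂_eq',
      MvPolynomial.eval_eq']
    simp only [map_sum, map_mul, map_prod, map_pow]
    refine Finset.sum_congr rfl fun s _ => ?_
    congr 1
    · simp
    · refine Finset.prod_congr rfl fun k _ => ?_
      congr 1
      split_ifs <;> simp
  by_contra hlt
  rw [not_le] at hlt
  set S := ⨆ x ∈ U, ENNReal.ofReal |polyProj PX (f 0) p h U x - f 0 x| with hS
  have hStop : S ≠ ∞ := ne_top_of_lt hlt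
  have hle : c * h ^ β * powGap β (strictFloor βbar) ≤ S.toReal := by
    refine powGap_le_of_abs_sub_le hc hh0.le hPdeg fun t ht0 ht1 => ?_
    let x : Ctx d := fun k => if k = i then t else 0
    have hxU : x ∈ U := by
      rw [hbin]
      constructor <;> intro k <;> simp only [x, Pi.zero_apply] <;> split_ifs <;> linarith
    have hxcube : x ∈ cube d := by
      constructor <;> intro k <;> simp only [x, Pi.zero_apply, Pi.one_apply] <;>
        split_ifs <;> linarith
    have hxi : x i = t := by simp [x]
    have h1 : ENNReal.ofReal |polyProj PX (f 0) p h U x - f 0 x| ≤ S :=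
      le_iSup₂ (f := fun x (_ : x ∈ U) => ENNReal.ofReal |polyProj PX (f 0) p h U x - f 0 x|) x hxU
    have h2 := (ENNReal.ofReal_le_iff_le_toReal hStop).1 h1
    rw [hg x hxU, hf x hxcube (by rw [hxi]; linarith), hxi] at h2
    rw [hPeval]
    convert h2 using 2
    ring
  have hpow : (q : ℝ) ^ (-((l : ℝ) * β)) = h ^ β := by
    rw [hh, Real.rpow_neg hq0.le, Real.rpow_mul hq0.le, Real.rpow_natCast,
      Real.inv_rpow (by positivity)]
  refine absurd hlt (not_lt.2 ?_)
  rw [hpow]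
  refine ENNReal.ofReal_le_of_le_toReal (le_trans ?_ hle)
  have := mul_le_mul_of_nonneg_right hb (Real.rpow_nonneg hh0.le β)
  linarith


/-! ### Hard instances -/

variable {d : ℕ}

/-- The sum over `j` of the copies of the bump `ε * Ψ`, moved to the ball of radius `h` about `c j`
and multiplied by `s j`. -/
noncomputable def bumps (Ψ : Ctx d → ℝ) (h ε : ℝ) {m : ℕ} (c : Fin m → Ctx d) (s : Fin m → ℝ)
    (x : Ctx d) : ℝ :=
  ∑ j, s j * (ε * Ψ (h⁻¹ • (x - c j)))

section bumps

variable {Ψ : Ctx d → ℝ} {h ε : ℝ} {m : ℕ} {c : Fin m → Ctx d} {s : Fin m → ℝ}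

theorem smul_sub_mem_ball_iff (hh : 0 < h) (x y : Ctx d) :
    h⁻¹ • (x - y) ∈ Metric.ball (0 : Ctx d) 1 ↔ x ∈ Metric.ball y h := by
  rw [mem_ball_zero_iff, norm_smul, norm_inv, Real.norm_of_nonneg hh.le, inv_mul_lt_iff₀ hh,
    mul_one, mem_ball_iff_norm]

theorem bumps_eq_of_mem (hh : 0 < h) (hΨ : ∀ x ∉ Metric.ball (0 : Ctx d) 1, Ψ x = 0)
    (hdisj : Pairwise (Function.onFun Disjoint fun j => Metric.ball (c j) h)) {j : Fin m}
    {x : Ctx d} (hx : x ∈ Metric.ball (c j) h) :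
    bumps Ψ h ε c s x = s j * (ε * Ψ (h⁻¹ • (x - c j))) := by
  refine Finset.sum_eq_single j (fun i _ hij => ?_) (by simp)
  rw [hΨ _ fun hmem => Set.disjoint_left.1 (hdisj hij) ((smul_sub_mem_ball_iff hh _ _).1 hmem) hx]
  simp

theorem bumps_eq_zero (hh : 0 < h) (hΨ : ∀ x ∉ Metric.ball (0 : Ctx d) 1, Ψ x = 0) {x : Ctx d}
    (hx : ∀ j, x ∉ Metric.ball (c j) h) : bumps Ψ h ε c s x = 0 :=
  Finset.sum_eq_zero fun j _ => by
    rw [hΨ _ fun hmem => hx j ((smul_sub_mem_ball_iff hh _ _).1 hmem)]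
    simp

theorem measurable_bumps (hΨ : Measurable Ψ) : Measurable (bumps Ψ h ε c s) :=
  Finset.measurable_sum _ fun j _ =>
    ((hΨ.comp ((measurable_id.sub_const (c j)).const_smul h⁻¹)).const_mul ε).const_mul (s j)

theorem holderDeriv_bumps {n : ℕ} {γ M a : ℝ} (hΨ : HolderDeriv n γ M Ψ) (hM : 0 ≤ M)
    (hγ : 0 < γ) (hsupp : ∀ x ∉ Metric.ball (0 : Ctx d) 1, iteratedFDeriv ℝ n Ψ x = 0)
    (hdisj : Pairwise (Function.onFun Disjoint fun j => Metric.ball (c j) h))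
    (hh : 0 < h) (ha : 0 ≤ a) (hs : ∀ j, |s j| ≤ 1) :
    HolderDeriv n γ (2 * (a * M)) (bumps Ψ h (a * h ^ (n + γ)) c s) := by
  let ℓ : Ctx d →L[ℝ] Ctx d := h⁻¹ • ContinuousLinearMap.id ℝ (Ctx d)
  have hℓ : ‖ℓ‖ ≤ h⁻¹ := by
    refine ContinuousLinearMap.opNorm_le_bound _ (by positivity) fun x => ?_
    simp [ℓ, norm_smul, abs_of_pos hh]
  have hbump : ∀ j, HolderDeriv n γ (a * M)
      (fun x => s j * (a * h ^ (n + γ) * Ψ (h⁻¹ • (x - c j)))) := fun j => by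
    have h1 := (((hΨ.comp_clm hM hγ.le ℓ).comp_add (-c j)).const_mul (a * h ^ (n + γ))).const_mul
      (s j)
    refine HolderDeriv.mono (M := |s j| * (|a * h ^ (n + γ)| * (M * ‖ℓ‖ ^ (n + γ)))) ?_ ?_
    · simpa [ℓ, sub_eq_add_neg] using h1
    · have h2 : ‖ℓ‖ ^ (n + γ) ≤ (h ^ (n + γ))⁻¹ := by
        rw [← Real.inv_rpow hh.le]
        exact Real.rpow_le_rpow (norm_nonneg _) hℓ (by positivity)
      have h3 : 0 < h ^ (n + γ) := Real.rpow_pos_of_pos hh _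
      calc |s j| * (|a * h ^ (n + γ)| * (M * ‖ℓ‖ ^ (n + γ)))
          ≤ 1 * (a * h ^ (n + γ) * (M * (h ^ (n + γ))⁻¹)) := by
            rw [abs_of_nonneg (by positivity : 0 ≤ a * h ^ (n + γ))]
            gcongr
            exact hs j
        _ = a * M := by field_simp
  refine HolderDeriv.sum_of_disjoint hbump (by positivity) (fun j x hx => ?_) hdisj
  have hx' : h⁻¹ • (x - c j) ∉ Metric.ball (0 : Ctx d) 1 := fun hmem =>
    hx ((smul_sub_mem_ball_iff hh _ _).1 hmem)
  have e1 : (fun x => s j * (a * h ^ (n + γ) * Ψ (h⁻¹ • (x - c j)))) =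
      fun x => (s j * (a * h ^ (n + γ))) • (Ψ ∘ ℓ) (x + -c j) := by
    funext x
    simp [ℓ, sub_eq_add_neg, mul_assoc]
  have hcd : ContDiff ℝ n fun x => (Ψ ∘ ℓ) (x + -c j) :=
    (hΨ.1.comp ℓ.contDiff).comp (contDiff_id.add contDiff_const)
  have hz : iteratedFDeriv ℝ n Ψ (ℓ (x + -c j)) = 0 := by
    rw [← hsupp _ hx']
    simp [ℓ, sub_eq_add_neg]
  rw [e1]
  refine (iteratedFDeriv_const_smul_apply (a := s j * (a * h ^ (n + γ))) hcd.contDiffAt).trans ?_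
  rw [iteratedFDeriv_comp_add_right,
    ℓ.iteratedFDeriv_comp_right hΨ.1 _ le_rfl, hz]
  ext v
  simp

end bumps

/-- The payoff `1 / 2 + A * G (lam * x_i)`, where `G` is a profile with a singularity at `0`. -/
noncomputable def roughPayoff (G : ℝ → ℝ) (A lam : ℝ) (i : Fin d) (x : Ctx d) : ℝ :=
  1 / 2 + A * G (lam * x i)

theorem holderDeriv_roughPayoff {n : ℕ} {γ M A lam : ℝ} {G : ℝ → ℝ} (hG : HolderDeriv n γ M G)
    (hM : 0 ≤ M) (hγ : 0 < γ) (hA : 0 ≤ A) (hlam : 0 < lam) (i : Fin d) :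
    HolderDeriv n γ (A * lam ^ (n + γ) * M) (roughPayoff G A lam i) := by
  let ℓ : Ctx d →L[ℝ] ℝ := lam • ContinuousLinearMap.proj i
  have hℓ : ‖ℓ‖ ≤ lam := by
    refine ContinuousLinearMap.opNorm_le_bound _ hlam.le fun x => ?_
    simp only [ℓ, _root_.smul_apply, ContinuousLinearMap.proj_apply, norm_smul]
    rw [Real.norm_of_nonneg hlam.le]
    exact mul_le_mul_of_nonneg_left (norm_le_pi_norm x i) hlam.le
  have h1 := (HolderDeriv.const (n := n) (γ := γ) (E := Ctx d) (1 / 2)).add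
    ((hG.comp_clm hM hγ.le ℓ).const_mul A)
  refine HolderDeriv.mono (M := 0 + |A| * (M * ‖ℓ‖ ^ (n + γ))) h1 ?_
  rw [zero_add, abs_of_nonneg hA]
  have h2 : ‖ℓ‖ ^ (n + γ) ≤ lam ^ (n + γ) :=
    Real.rpow_le_rpow (norm_nonneg _) hℓ (by positivity)
  calc A * (M * ‖ℓ‖ ^ (n + γ)) ≤ A * (M * lam ^ (n + γ)) := by gcongr
    _ = _ := by ring

/-- The sign `±1` encoded by a Boolean. -/
def signVal (s : Bool) : ℝ := if s then 1 else -1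

theorem abs_signVal (s : Bool) : |signVal s| = 1 := by
  cases s <;> simp [signVal]

/-- The main construction. The payoff of arm `0` is a rough function that makes the problem
self-similar, and the payoff of arm `1` differs from it by `m` bumps with unknown signs, of width
`h` and height `a * h ^ β`. Each of the two functions gets half of the Hölder constant `L`. In the
hypotheses, `K * h ^ d` measures the part of a cell on which the bump is small but positive, `w`
bounds the probability of a cell, and `K' * h ^ d` bounds from below the mass of a cell weighted by
the bump. -/
theorem exists_hard_instance (π : Policy.{u} d) {PX : Measure (Ctx d)}
    (hprob : IsProbabilityMeasure PX) (hcube : PX (cube d)ᶜ = 0) (i : Fin d)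
    {n : ℕ} {γ β βbar L α C₀ b l₀ : ℝ} (hγ : 0 < γ) (hn : strictFloor β = n) (hβ : β = n + γ)
    {G : ℝ → ℝ} {MG B : ℝ} (hG : HolderDeriv n γ MG G) (hMG : 0 ≤ MG) (hGB : ∀ t, |G t| ≤ B)
    (hGpow : ∀ t, 0 ≤ t → t ≤ 1 → G t = t ^ (n + γ))
    {Ψ : Ctx d → ℝ} {M : ℝ} (hΨ : HolderDeriv n γ M Ψ) (hM : 0 ≤ M)
    (hΨ0 : ∀ x, 0 ≤ Ψ x) (hΨ1 : ∀ x, Ψ x ≤ 1)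
    (hsupp : ∀ x ∉ Metric.ball (0 : Ctx d) 1, Ψ x = 0)
    (hsupp' : ∀ x ∉ Metric.ball (0 : Ctx d) 1, iteratedFDeriv ℝ n Ψ x = 0)
    {h a c₁ : ℝ} {m : ℕ} {c : Fin m → Ctx d} (hh : 0 < h) (hh1 : h ≤ 1)
    (hdisj : Pairwise (Function.onFun Disjoint fun j => Metric.ball (c j) h))
    (ha : 0 < a) (ha8 : a ≤ 1 / 8) (haL : 2 * (a * M) ≤ L / 2)
    (hc₁ : 0 ≤ c₁) (hcB : c₁ * B ≤ 1 / 8 * (2 : ℝ) ^ (l₀ * β)) (hcL : c₁ * MG ≤ L / 2)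
    (hb : b ≤ c₁ * powGap β (strictFloor βbar))
    (hPX0 : ∀ r : ℝ, 0 < r → PX (Set.Icc 0 (fun _ => r)) ≠ 0)
    {K : ℝ} (hmargin : ∀ j, ∀ δ, 0 < δ →
      PX {x | x ∈ Metric.ball (c j) h ∧ 0 < Ψ (h⁻¹ • (x - c j)) ∧
        a * h ^ β * Ψ (h⁻¹ • (x - c j)) ≤ δ} ≤
          ENNReal.ofReal (K * h ^ d * (δ / (a * h ^ β)) ^ α))
    (hC₀ : m * h ^ d * K * (a * h ^ β) ^ (-α) ≤ C₀)
    {w K' : ℝ} (hw : ∀ j, PX.real (Metric.ball (c j) h) ≤ w)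
    (hmass : ∀ j, ENNReal.ofReal (K' * h ^ d * (a * h ^ β)) ≤ ∫⁻ x in Metric.ball (c j) h,
      ENNReal.ofReal (a * h ^ β * Ψ (h⁻¹ • (x - c j))) ∂PX)
    {T : ℕ} (hT : T * ((2 * (a * h ^ β)) ^ 2 * w) ≤ 1 / 4) :
    ∃ P : Instance d, P.PX = PX ∧ (∀ k, Holder β L (P.payoff k)) ∧
      Margin P.PX P.payoff α C₀ ∧ SelfSimilar P.PX P.payoff β βbar b l₀ ∧
      T * m * (K' * h ^ d * (a * h ^ β)) / 8 ≤ π.regret P T := by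
  set ε := a * h ^ β with hε
  have hβ0 : 0 < β := by rw [hβ]; positivity
  have hε0 : 0 < ε := by positivity
  have hε8 : ε ≤ 1 / 8 :=
    (mul_le_of_le_one_right ha.le (Real.rpow_le_one hh.le hh1 hβ0.le)).trans ha8
  set lam : ℝ := (2 : ℝ) ^ l₀ with hlam
  have hlam0 : 0 < lam := by positivity
  have hlamβ : lam ^ β = (2 : ℝ) ^ (l₀ * β) := (Real.rpow_mul (by norm_num) _ _).symm
  have hlamβ0 : 0 < lam ^ β := by positivity
  -- scaling the profile by `lam` moves its pure power part from `[0, 1]` to `[0, 2 ^ (-l₀)]`, which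
  -- contains the edges of all the corner bins that matter
  set A := c₁ / lam ^ β with hA
  have hA0 : 0 ≤ A := by positivity
  set g := roughPayoff (d := d) G A lam i with hg
  have hgH : HolderDeriv n γ (L / 2) g := by
    refine (holderDeriv_roughPayoff hG hMG hγ hA0 hlam0 i).mono ?_
    rw [← hβ, hA, div_mul_cancel₀ _ hlamβ0.ne']
    exact hcL
  have hL2 : 0 ≤ L / 2 := le_trans (by positivity) hcL
  have hg8 : ∀ x, |g x - 1 / 2| ≤ 1 / 8 := fun x => by
    have h1 : g x - 1 / 2 = A * G (lam * x i) := by simp [hg, roughPayoff]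
    rw [h1, abs_mul, abs_of_nonneg hA0]
    refine (mul_le_mul_of_nonneg_left (hGB _) hA0).trans ?_
    rw [hA, div_mul_eq_mul_div, div_le_iff₀ hlamβ0, hlamβ]
    exact hcB
  let s : (Fin m → Bool) → Fin m → ℝ := fun σ j => signVal (σ j)
  let Δ : (Fin m → Bool) → Ctx d → ℝ := fun σ => bumps Ψ h ε c (s σ)
  have hΔH : ∀ σ, HolderDeriv n γ (L / 2) (Δ σ) := fun σ => by
    have := holderDeriv_bumps (c := c) (s := s σ) hΨ hM hγ hsupp' hdisj hh ha.le
      fun j => (abs_signVal (σ j)).le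
    rw [← hβ, ← hε] at this
    exact this.mono haL
  have hΔon : ∀ σ j, ∀ x ∈ Metric.ball (c j) h,
      Δ σ x = signVal (σ j) * (ε * Ψ (h⁻¹ • (x - c j))) := fun σ j x hx =>
    bumps_eq_of_mem hh hsupp hdisj hx
  have hΔoff : ∀ σ x, (∀ j, x ∉ Metric.ball (c j) h) → Δ σ x = 0 := fun σ x hx =>
    bumps_eq_zero hh hsupp hx
  have hεΨ : ∀ x, 0 ≤ ε * Ψ x ∧ ε * Ψ x ≤ ε := fun x =>
    ⟨mul_nonneg hε0.le (hΨ0 x), mul_le_of_le_one_right hε0.le (hΨ1 x)⟩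
  have hΔ8 : ∀ σ x, |Δ σ x| ≤ 1 / 8 := fun σ x => by
    by_cases hx : ∃ j, x ∈ Metric.ball (c j) h
    · obtain ⟨j, hj⟩ := hx
      rw [hΔon σ j x hj, abs_mul, abs_signVal, one_mul, abs_of_nonneg (hεΨ _).1]
      exact (hεΨ _).2.trans hε8
    · rw [hΔoff σ x fun j hj => hx ⟨j, hj⟩, abs_zero]
      norm_num
  have hgm : Measurable g := hgH.1.continuous.measurable
  have hΔm : ∀ σ, Measurable (Δ σ) := fun σ => (hΔH σ).1.continuous.measurable
  let f : (Fin m → Bool) → Fin 2 → Ctx d → ℝ := fun σ k =>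
    if k = 0 then g else fun x => g x + Δ σ x
  have hf0 : ∀ σ, f σ 0 = g := fun σ => rfl
  have hf1 : ∀ σ, f σ 1 = fun x => g x + Δ σ x := fun σ => rfl
  have hfm : ∀ σ k, Measurable (f σ k) := fun σ k => by
    fin_cases k
    · exact hgm
    · exact hgm.add (hΔm σ)
  have hf4 : ∀ σ k x, f σ k x ∈ Set.Icc (1 / 4 : ℝ) (3 / 4) := fun σ k x => by
    have h1 := abs_le.1 (hg8 x)
    have h2 := abs_le.1 (hΔ8 σ x)
    fin_cases k
    · change g x ∈ _
      constructor <;> linarith [h1.1, h1.2]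
    · change g x + Δ σ x ∈ _
      constructor <;> linarith [h1.1, h1.2, h2.1, h2.2]
  have hf01 : ∀ σ k x, f σ k x ∈ Set.Icc (0 : ℝ) 1 := fun σ k x =>
    Set.Icc_subset_Icc (by norm_num) (by norm_num) (hf4 σ k x)
  -- the common absolute value of the differences of the payoffs
  let φ : Ctx d → ℝ := bumps Ψ h ε c fun _ => 1
  have hφon : ∀ j, ∀ x ∈ Metric.ball (c j) h, φ x = ε * Ψ (h⁻¹ • (x - c j)) := fun j x hx => by
    rw [← one_mul (ε * _)]
    exact bumps_eq_of_mem hh hsupp hdisj hx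
  have hφoff : ∀ x, (∀ j, x ∉ Metric.ball (c j) h) → φ x = 0 := fun x hx =>
    bumps_eq_zero hh hsupp hx
  have hφ : ∀ x, 0 ≤ φ x ∧ φ x ≤ ε := fun x => by
    by_cases hx : ∃ j, x ∈ Metric.ball (c j) h
    · obtain ⟨j, hj⟩ := hx
      rw [hφon j x hj]
      exact hεΨ _
    · rw [hφoff x fun j hj => hx ⟨j, hj⟩]
      exact ⟨le_rfl, hε0.le⟩
  obtain ⟨σ, hσ⟩ := exists_regret_ge π hprob hcube hfm hf4 hf01
    (A := fun j => Metric.ball (c j) h) (fun j => Metric.isOpen_ball.measurableSet) hdisj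
    (φ := φ) (measurable_bumps hΨ.1.continuous.measurable) (ε := ε) (w := w)
    (I := K' * h ^ d * ε) (fun x => (hφ x).1) (fun x => (hφ x).2) (fun σ σ' => rfl)
    (fun σ j x hx => by
      rw [hf1, hf0, hφon j x hx, ← signVal, ← hΔon σ j x hx])
    (fun σ x hx => by
      change g x + Δ σ x = g x
      rw [hΔoff σ x hx, add_zero])
    hw (fun j => (hmass j).trans_eq
      (setLIntegral_congr_fun Metric.isOpen_ball.measurableSet fun x hx => by
        simp only [hφon j x hx])) hT
  have hHolder : ∀ k, Holder β L (f σ k) := fun k => by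
    fin_cases k
    · exact HolderDeriv.holder (hgH.mono (by linarith)) (by linarith) hγ.le hn hβ
    · exact HolderDeriv.holder ((hgH.add (hΔH σ)).mono (by linarith)) (by linarith) hγ.le hn hβ
  refine ⟨bernoulliInstance PX hprob hcube (f σ) (hfm σ) (hf01 σ), rfl, ?_, ?_, ?_, hσ⟩
  · intro k
    rw [bernoulliInstance_payoff]
    exact hHolder k
  · intro δ hδ _
    rw [bernoulliInstance_payoff, bernoulliInstance_payoff]
    change PX {x | 0 < |g x - (g x + Δ σ x)| ∧ |g x - (g x + Δ σ x)| ≤ δ} ≤ _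
    have hsub : {x | 0 < |g x - (g x + Δ σ x)| ∧ |g x - (g x + Δ σ x)| ≤ δ} ⊆
        ⋃ j, {x | x ∈ Metric.ball (c j) h ∧ 0 < Ψ (h⁻¹ • (x - c j)) ∧
          ε * Ψ (h⁻¹ • (x - c j)) ≤ δ} := fun x hx => by
      obtain ⟨h1, h2⟩ := hx
      rw [sub_add_cancel_left, abs_neg] at h1 h2
      by_cases hx : ∃ j, x ∈ Metric.ball (c j) h
      · obtain ⟨j, hj⟩ := hx
        rw [hΔon σ j x hj, abs_mul, abs_signVal, one_mul, abs_of_nonneg (hεΨ _).1] at h1 h2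
        exact Set.mem_iUnion.2 ⟨j, hj, pos_of_mul_pos_right h1 hε0.le, h2⟩
      · rw [hΔoff σ x fun j hj => hx ⟨j, hj⟩, abs_zero] at h1
        exact absurd h1 (lt_irrefl _)
    refine (measure_mono hsub).trans ((measure_iUnion_le _).trans ?_)
    rw [tsum_fintype]
    refine (Finset.sum_le_sum fun j _ => hmargin j δ hδ).trans ?_
    rw [Finset.sum_const, Finset.card_univ, Fintype.card_fin, nsmul_eq_mul,
      ← ENNReal.ofReal_natCast, ← ENNReal.ofReal_mul (by positivity)]
    refine ENNReal.ofReal_le_ofReal ?_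
    calc (m : ℝ) * (K * h ^ d * (δ / ε) ^ α)
        = m * h ^ d * K * ε ^ (-α) * δ ^ α := by
          rw [Real.div_rpow hδ.le hε0.le, Real.rpow_neg hε0.le]
          ring
      _ ≤ C₀ * δ ^ α := by gcongr
  · have hpay : (bernoulliInstance PX hprob hcube (f σ) (hfm σ) (hf01 σ)).payoff = f σ :=
      funext fun k => bernoulliInstance_payoff k
    rw [hpay]
    refine selfSimilar_of_eq_pow (a := 1 / 2) (c := c₁) (fun k => ⟨L, hHolder k⟩) hc₁ i hb
      (fun x hx hxi => ?_) hPX0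
    change 1 / 2 + A * G (lam * x i) = _
    have hxi0 : 0 ≤ x i := hx.1 i
    have hle : lam * x i ≤ 1 := by
      calc lam * x i ≤ lam * (2 : ℝ) ^ (-l₀) := by gcongr
        _ = 1 := by rw [hlam, ← Real.rpow_add (by norm_num)]; simp
    rw [hGpow _ (by positivity) hle, ← hβ, Real.mul_rpow hlam0.le hxi0, hA]
    field_simp


/-! ### Cells and context distributions -/

variable {d : ℕ}

/-- Disjoint balls of radius `h` in `[s₀, 1]ᵈ`, of total volume of order `h ^ (α * β)`. They are
picked from the grid of cubes of side `2 * h`. -/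
theorem exists_cells {s₀ ϑ h α β : ℝ} (hh : 0 < h) (hh1 : h ≤ 1)
    (h2 : 2 * h ≤ 1 - s₀) (hϑ0 : 0 < ϑ) (hϑ : ϑ ≤ ((1 - s₀) / 4) ^ d) (hαβ : 0 ≤ α * β) :
    ∃ (m : ℕ) (c : Fin m → Ctx d), (∀ j i, s₀ + h ≤ c j i ∧ c j i + h ≤ 1) ∧
      Pairwise (Function.onFun Disjoint fun j => Metric.ball (c j) h) ∧
      ϑ * h ^ (α * β) ≤ m * h ^ d ∧ m * h ^ d ≤ ϑ * h ^ (α * β) + h ^ d := by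
  have hhd : 0 < h ^ d := by positivity
  set x := ϑ * h ^ (α * β) / h ^ d with hx
  have hx0 : 0 ≤ x := by positivity
  -- number of cells per direction
  set N := ⌊(1 - s₀) / (2 * h)⌋₊ with hN
  have hNle : (N : ℝ) * (2 * h) ≤ 1 - s₀ := by
    rw [← le_div_iff₀ (by positivity)]
    exact Nat.floor_le (div_nonneg (by linarith) (by linarith))
  have hNge : (1 - s₀) / (4 * h) ≤ N := by
    have h1 : 1 ≤ (1 - s₀) / (2 * h) := (one_le_div₀ (by positivity)).2 h2
    have h3 : (1 : ℝ) ≤ N := by exact_mod_cast Nat.one_le_floor_iff _ |>.2 h1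
    have h4 := Nat.lt_floor_add_one ((1 - s₀) / (2 * h))
    have h5 : (1 - s₀) / (4 * h) = (1 - s₀) / (2 * h) / 2 := by
      field_simp
      norm_num
    rw [h5]
    linarith
  have hxN : x ≤ ((N ^ d : ℕ) : ℝ) := by
    rw [hx, div_le_iff₀ hhd]
    calc ϑ * h ^ (α * β) ≤ ϑ * 1 := by
          gcongr
          exact Real.rpow_le_one hh.le hh1 hαβ
      _ ≤ ((1 - s₀) / 4) ^ d := by linarith
      _ = ((1 - s₀) / (4 * h) * h) ^ d := by
          congr 1
          field_simp
      _ ≤ (N * h) ^ d := by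
          refine pow_le_pow_left₀ (mul_nonneg (div_nonneg (by linarith) (by linarith)) hh.le) ?_ d
          gcongr
      _ = ((N ^ d : ℕ) : ℝ) * h ^ d := by
          push_cast
          rw [mul_pow]
  have hmN : ⌈x⌉₊ ≤ N ^ d := Nat.ceil_le.2 hxN
  obtain ⟨e⟩ : Nonempty (Fin ⌈x⌉₊ ↪ (Fin d → Fin N)) :=
    Function.Embedding.nonempty_of_card_le (by simpa using hmN)
  refine ⟨⌈x⌉₊, fun j i => s₀ + (2 * ((e j i : ℕ) : ℝ) + 1) * h, fun j i => ?_, ?_, ?_, ?_⟩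
  · have h1 : ((e j i : ℕ) : ℝ) + 1 ≤ N := by exact_mod_cast (e j i).isLt
    have h3 : (0 : ℝ) ≤ (e j i : ℕ) := Nat.cast_nonneg _
    constructor
    · nlinarith [mul_nonneg h3 hh.le]
    · nlinarith [mul_le_mul_of_nonneg_right h1 hh.le]
  · intro j k hjk
    obtain ⟨i, hi⟩ : ∃ i, e j i ≠ e k i := by
      by_contra! hcon
      exact hjk (e.injective (funext hcon))
    refine Metric.ball_disjoint_ball ?_
    refine le_trans ?_ (dist_le_pi_dist _ _ i)
    rw [Real.dist_eq]
    have h1 : s₀ + (2 * ((e j i : ℕ) : ℝ) + 1) * h - (s₀ + (2 * ((e k i : ℕ) : ℝ) + 1) * h) =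
        (((e j i : ℕ) : ℤ) - ((e k i : ℕ) : ℤ) : ℤ) * (2 * h) := by
      push_cast
      ring
    rw [h1, abs_mul, abs_of_pos (by positivity : 0 < 2 * h), ← two_mul]
    refine le_mul_of_one_le_left (by positivity) ?_
    rw [← Int.cast_abs]
    have h3 : (1 : ℤ) ≤ |((e j i : ℕ) : ℤ) - ((e k i : ℕ) : ℤ)| := by
      refine Int.one_le_abs (sub_ne_zero.2 ?_)
      exact_mod_cast fun h => hi (Fin.ext h)
    exact_mod_cast h3
  · rw [← div_le_iff₀ hhd]
    exact Nat.le_ceil x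
  · have h1 := (Nat.ceil_lt_add_one hx0).le
    have h3 := mul_le_mul_of_nonneg_right h1 hhd.le
    rwa [add_mul, one_mul, hx, div_mul_cancel₀ _ hhd.ne'] at h3

theorem ball_subset_cube {s₀ h : ℝ} (hs₀ : 0 ≤ s₀) {y : Ctx d}
    (hy : ∀ i, s₀ + h ≤ y i ∧ y i + h ≤ 1) : Metric.ball y h ⊆ cube d := by
  intro x hx
  have hxi : ∀ i, |x i - y i| < h := fun i =>
    (dist_le_pi_dist x y i).trans_lt hx
  constructor <;> intro i
  · have := (abs_lt.1 (hxi i)).1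
    have := (hy i).1
    simp only [Pi.zero_apply]
    linarith
  · have := (abs_lt.1 (hxi i)).2
    have := (hy i).2
    simp only [Pi.one_apply]
    linarith

/-- The measure with the constant density `ρ` on `S`. -/
noncomputable def constDensity (S : Set (Ctx d)) (ρ : ℝ) : Measure (Ctx d) :=
  (volume.restrict S).withDensity fun _ => ENNReal.ofReal ρ

theorem constDensity_apply (S : Set (Ctx d)) (ρ : ℝ) {A : Set (Ctx d)} (hA : MeasurableSet A) :
    constDensity S ρ A = ENNReal.ofReal ρ * volume (A ∩ S) := by
  rw [constDensity, withDensity_const, Measure.smul_apply, smul_eq_mul, Measure.restrict_apply hA]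

theorem isProbabilityMeasure_constDensity {S : Set (Ctx d)} {ρ : ℝ}
    (h : ENNReal.ofReal ρ * volume S = 1) : IsProbabilityMeasure (constDensity S ρ) :=
  ⟨by rw [constDensity_apply _ _ MeasurableSet.univ, Set.univ_inter, h]⟩

theorem measurableSet_cube : MeasurableSet (cube d) := measurableSet_Icc

theorem constDensity_cube_compl {S : Set (Ctx d)} {ρ : ℝ} (h : S ⊆ cube d) :
    constDensity S ρ (cube d)ᶜ = 0 := by
  rw [constDensity_apply _ _ measurableSet_cube.compl,
    (Set.disjoint_compl_left_iff_subset.2 h).inter_eq, measure_empty, mul_zero]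

theorem densityOn_constDensity {S : Set (Ctx d)} {ρ ρlo ρhi : ℝ} (h1 : ρlo ≤ ρ) (h2 : ρ ≤ ρhi) :
    DensityOn (constDensity S ρ) S ρlo ρhi :=
  ⟨fun _ => ρ, measurable_const, fun _ _ => ⟨h1, h2⟩, rfl⟩

theorem constDensity_Icc_ne_zero {S : Set (Ctx d)} {ρ s : ℝ} (hρ : 0 < ρ) (hs : 0 < s)
    (hS : Set.Icc 0 (fun _ => s) ⊆ S) {r : ℝ} (hr : 0 < r) :
    constDensity S ρ (Set.Icc 0 (fun _ => r)) ≠ 0 := by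
  rw [constDensity_apply _ _ measurableSet_Icc]
  refine mul_ne_zero (by simpa using hρ) (ne_of_gt ?_)
  have hsub : Set.Icc (0 : Ctx d) (fun _ => min r s) ⊆ Set.Icc 0 (fun _ => r) ∩ S := fun x hx =>
    ⟨⟨hx.1, hx.2.trans fun _ => min_le_left _ _⟩, hS ⟨hx.1, hx.2.trans fun _ => min_le_right _ _⟩⟩
  refine lt_of_lt_of_le ?_ (measure_mono hsub)
  rw [Real.volume_Icc_pi]
  refine pos_iff_ne_zero.2 (Finset.prod_ne_zero_iff.2 fun i _ => ?_)
  simp [hr, hs]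

theorem constDensity_real_ball_le (S : Set (Ctx d)) {ρ h : ℝ} (hρ : 0 ≤ ρ) (hh : 0 < h)
    (y : Ctx d) : (constDensity S ρ).real (Metric.ball y h) ≤ ρ * (2 * h) ^ d := by
  rw [Measure.real, constDensity_apply _ _ Metric.isOpen_ball.measurableSet]
  refine ENNReal.toReal_le_of_le_ofReal (by positivity) ?_
  rw [ENNReal.ofReal_mul hρ]
  refine mul_le_mul_right ((measure_mono Set.inter_subset_left).trans_eq ?_) _
  rw [Real.volume_pi_ball _ hh, Fintype.card_fin]

/-! ### The tent bump and the uniform distribution -/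

/-- The tent `(1 - ‖x‖)₊ ^ β`. -/
noncomputable def tent (β : ℝ) (x : Ctx d) : ℝ := posPow β (1 - ‖x‖)

theorem holderDeriv_tent {β : ℝ} (h0 : 0 < β) (h1 : β ≤ 1) :
    HolderDeriv 0 β 1 (tent (d := d) β) := by
  refine HolderDeriv.of_continuous
    ((continuous_posPow h0.le).comp (continuous_const.sub continuous_norm)) fun x y => ?_
  refine (abs_posPow_sub_le h0 h1 _ _).trans ?_
  rw [one_mul, sub_sub_sub_cancel_left, abs_sub_comm]
  exact Real.rpow_le_rpow (abs_nonneg _) (abs_norm_sub_norm_le x y) h0.le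

theorem tent_le_one {β : ℝ} (h0 : 0 < β) (x : Ctx d) : tent β x ≤ 1 :=
  Real.rpow_le_one (le_max_right _ _) (max_le (by linarith [norm_nonneg x]) zero_le_one) h0.le

theorem tent_eq_zero {β : ℝ} (h0 : 0 < β) {x : Ctx d} (hx : x ∉ Metric.ball (0 : Ctx d) 1) :
    tent β x = 0 := by
  rw [mem_ball_zero_iff, not_lt] at hx
  exact posPow_of_nonpos h0.ne' (by linarith)

/-- The level sets of a tent near its boundary are thin. -/
theorem volume_tent_le {β α h ε δ : ℝ} (hβ : 0 < β) (hαβ : α ≤ 1 / β) (hα : 0 ≤ α)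
    (hh : 0 < h) (hε : 0 < ε) (hδ : 0 < δ) (hd : 0 < d) (y : Ctx d) :
    volume {x | x ∈ Metric.ball y h ∧ 0 < tent β (h⁻¹ • (x - y)) ∧
      ε * tent β (h⁻¹ • (x - y)) ≤ δ} ≤
        ENNReal.ofReal (d * 2 ^ d * h ^ d * (δ / ε) ^ α) := by
  have hd1 : (1 : ℝ) ≤ d := by exact_mod_cast hd
  have hball : ∀ r, 0 < r → volume (Metric.ball y r) = ENNReal.ofReal ((2 * r) ^ d) :=
      fun r hr => by
    rw [Real.volume_pi_ball _ hr, Fintype.card_fin]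
  have hr0 : 0 < δ / ε := by positivity
  rcases le_or_gt 1 (δ / ε) with hr | hr
  · refine (measure_mono (t := Metric.ball y h) fun x hx => hx.1).trans ?_
    rw [hball h hh]
    refine ENNReal.ofReal_le_ofReal ?_
    have h1 : 1 ≤ (δ / ε) ^ α := Real.one_le_rpow hr hα
    have h2 : (0 : ℝ) ≤ 2 ^ d * h ^ d := by positivity
    calc (2 * h) ^ d = 1 * (2 ^ d * h ^ d) * 1 := by rw [mul_pow]; ring
      _ ≤ d * (2 ^ d * h ^ d) * (δ / ε) ^ α := by gcongr
      _ = _ := by ring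
  · set v := (δ / ε) ^ (1 / β) with hv
    have hv0 : 0 < v := by positivity
    have hv1 : v < 1 := Real.rpow_lt_one hr0.le hr (by positivity)
    have hvα : v ≤ (δ / ε) ^ α := Real.rpow_le_rpow_of_exponent_ge hr0 hr.le hαβ
    have hin : 0 < h * (1 - v) := mul_pos hh (by linarith)
    have hsub : {x | x ∈ Metric.ball y h ∧ 0 < tent β (h⁻¹ • (x - y)) ∧
        ε * tent β (h⁻¹ • (x - y)) ≤ δ} ⊆ Metric.ball y h \ Metric.ball y (h * (1 - v)) := by
      rintro x ⟨h1, -, h3⟩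
      refine ⟨h1, fun h4 => ?_⟩
      rw [mem_ball_iff_norm] at h4
      have h5 : v < 1 - ‖h⁻¹ • (x - y)‖ := by
        rw [norm_smul, norm_inv, Real.norm_of_nonneg hh.le, lt_sub_comm, inv_mul_lt_iff₀ hh]
        exact h4
      have h6 : δ / ε < tent β (h⁻¹ • (x - y)) := by
        rw [tent, posPow_of_nonneg _ (by linarith)]
        calc δ / ε = v ^ β := by
              rw [hv, ← Real.rpow_mul hr0.le, one_div_mul_cancel hβ.ne', Real.rpow_one]
          _ < _ := Real.rpow_lt_rpow hv0.le h5 hβ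
      rw [div_lt_iff₀ hε] at h6
      linarith
    refine (measure_mono hsub).trans ?_
    rw [measure_sdiff (Metric.ball_subset_ball (by nlinarith))
      Metric.isOpen_ball.measurableSet.nullMeasurableSet (by rw [hball _ hin]; simp),
      hball h hh, hball _ hin, ← ENNReal.ofReal_sub _ (by positivity)]
    refine ENNReal.ofReal_le_ofReal ?_
    have hbern := one_add_mul_le_pow (a := -v) (by linarith) d
    have h2 : (0 : ℝ) ≤ 2 ^ d * h ^ d := by positivity
    calc (2 * h) ^ d - (2 * (h * (1 - v))) ^ d
        = 2 ^ d * h ^ d * (1 - (1 + -v) ^ d) := by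
          rw [mul_pow, mul_pow, mul_pow, ← sub_eq_add_neg]
          ring
      _ ≤ 2 ^ d * h ^ d * (d * v) := by
          gcongr
          linarith
      _ ≤ 2 ^ d * h ^ d * (d * (δ / ε) ^ α) := by gcongr
      _ = _ := by ring

theorem half_le_lintegral_tent {β h ε : ℝ} (hβ : 0 < β) (hβ1 : β ≤ 1) (hh : 0 < h) (hε : 0 < ε)
    {y : Ctx d} (hy : Metric.ball y h ⊆ cube d) :
    ENNReal.ofReal (1 / 2 * h ^ d * ε) ≤ ∫⁻ x in Metric.ball y h,
      ENNReal.ofReal (ε * tent β (h⁻¹ • (x - y))) ∂(constDensity (cube d) 1) := by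
  have hsub : Metric.closedBall y (h / 2) ⊆ Metric.ball y h :=
    Metric.closedBall_subset_ball (by linarith)
  calc ENNReal.ofReal (1 / 2 * h ^ d * ε)
      = ENNReal.ofReal (ε * (1 / 2)) * constDensity (cube d) 1 (Metric.closedBall y (h / 2)) := by
        rw [constDensity_apply _ _ Metric.isClosed_closedBall.measurableSet,
          Set.inter_eq_left.2 (hsub.trans hy), Real.volume_pi_closedBall _ (by positivity),
          Fintype.card_fin, ENNReal.ofReal_one, one_mul, ← ENNReal.ofReal_mul (by positivity)]
        congr 1
        rw [mul_div_cancel₀ _ two_ne_zero]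
        ring
    _ = ∫⁻ _ in Metric.closedBall y (h / 2), ENNReal.ofReal (ε * (1 / 2))
          ∂(constDensity (cube d) 1) := (setLIntegral_const _ _).symm
    _ ≤ ∫⁻ x in Metric.closedBall y (h / 2), ENNReal.ofReal (ε * tent β (h⁻¹ • (x - y)))
          ∂(constDensity (cube d) 1) := by
        refine setLIntegral_mono' Metric.isClosed_closedBall.measurableSet fun x hx => ?_
        refine ENNReal.ofReal_le_ofReal (mul_le_mul_of_nonneg_left ?_ hε.le)
        rw [mem_closedBall_iff_norm] at hx
        have h1 : 1 / 2 ≤ 1 - ‖h⁻¹ • (x - y)‖ := by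
          rw [norm_smul, norm_inv, Real.norm_of_nonneg hh.le, le_sub_comm, inv_mul_le_iff₀ hh]
          linarith
        rw [tent, posPow_of_nonneg _ (by linarith)]
        calc (1 / 2 : ℝ) = (1 / 2 : ℝ) ^ (1 : ℝ) := (Real.rpow_one _).symm
          _ ≤ (1 / 2 : ℝ) ^ β :=
            Real.rpow_le_rpow_of_exponent_ge (by norm_num) (by norm_num) hβ1
          _ ≤ _ := Real.rpow_le_rpow (by norm_num) h1 hβ.le
    _ ≤ _ := lintegral_mono_set hsub

/-! ### The plateau bump and a distribution with gaps -/

/-- A smooth bump with a plateau, supported well inside the unit ball. -/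
theorem exists_plateau (n : ℕ) {γ : ℝ} (hγ0 : 0 < γ) (hγ1 : γ ≤ 1) :
    ∃ (Ψ : Ctx d → ℝ) (M : ℝ), 0 < M ∧ HolderDeriv n γ M Ψ ∧ (∀ x, 0 ≤ Ψ x) ∧ (∀ x, Ψ x ≤ 1) ∧
      (∀ x ∈ Metric.closedBall (0 : Ctx d) (1 / 4), Ψ x = 1) ∧
      (∀ x ∉ Metric.ball (0 : Ctx d) 1, Ψ x = 0) ∧
      ∀ x ∉ Metric.ball (0 : Ctx d) 1, iteratedFDeriv ℝ n Ψ x = 0 := by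
  let B : ContDiffBump (0 : Ctx d) := ⟨1 / 4, 1 / 2, by norm_num, by norm_num⟩
  have hB : ContDiff ℝ ((n : ℕ∞) + 1) B := B.contDiff
  have hcs : HasCompactSupport B := B.hasCompactSupport
  have hD1 : ContDiff ℝ 1 (iteratedFDeriv ℝ n B) := hB.iteratedFDeriv_right (by
    rw [add_comm]
    norm_cast)
  have hDc : HasCompactSupport (iteratedFDeriv ℝ n B) := hcs.iteratedFDeriv n
  obtain ⟨C, hC⟩ := hDc.exists_bound_of_continuous hD1.continuous
  obtain ⟨K, hK⟩ := hD1.lipschitzWith_of_hasCompactSupport hDc one_ne_zero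
  have hC0 : 0 ≤ C := (norm_nonneg _).trans (hC 0)
  have hout : ∀ x ∉ Metric.ball (0 : Ctx d) 1, x ∉ tsupport B := fun x hx hxt => by
    rw [B.tsupport_eq] at hxt
    exact hx (Metric.closedBall_subset_ball (by norm_num : (1 / 2 : ℝ) < 1) hxt)
  refine ⟨B, K + 2 * C + 1, by positivity, ⟨hB.of_le (by norm_cast; simp), fun x y => ?_⟩,
    fun x => B.nonneg, fun x => B.le_one, fun x hx => B.one_of_mem_closedBall hx,
    fun x hx => image_eq_zero_of_notMem_tsupport (hout x hx), fun x hx => ?_⟩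
  · have hK0 : (0 : ℝ) ≤ K := K.2
    rcases le_total ‖x - y‖ 1 with h1 | h1
    · have h2 : ‖x - y‖ ≤ ‖x - y‖ ^ γ := by
        rcases (norm_nonneg (x - y)).eq_or_lt with h0 | h0
        · rw [← h0]
          exact Real.rpow_nonneg le_rfl _
        · calc ‖x - y‖ = ‖x - y‖ ^ (1 : ℝ) := (Real.rpow_one _).symm
            _ ≤ _ := Real.rpow_le_rpow_of_exponent_ge h0 h1 hγ1
      have h3 := hK.dist_le_mul x y
      rw [dist_eq_norm, dist_eq_norm] at h3
      calc _ ≤ K * ‖x - y‖ := h3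
        _ ≤ (K + 2 * C + 1) * ‖x - y‖ ^ γ := by
          gcongr
          linarith
    · have h2 : 1 ≤ ‖x - y‖ ^ γ := Real.one_le_rpow h1 hγ0.le
      calc _ ≤ 2 * C := (norm_sub_le _ _).trans (by linarith [hC x, hC y])
        _ ≤ (K + 2 * C + 1) * 1 := by linarith
        _ ≤ _ := by gcongr
  · exact image_eq_zero_of_notMem_tsupport fun h => hout x hx (tsupport_iteratedFDeriv_subset n h)

/-- The part `x_i ≤ s` of the cube. -/
def slab (i : Fin d) (s : ℝ) : Set (Ctx d) := Set.Icc 0 (Function.update 1 i s)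

theorem volume_slab (i : Fin d) {s : ℝ} : volume (slab i s) = ENNReal.ofReal s := by
  rw [slab, Real.volume_Icc_pi, Finset.prod_eq_single i]
  · simp
  · intro j _ hj
    simp [Function.update_of_ne hj]
  · simp

/-- A slab, together with a small ball inside each cell. The transition zones of plateau bumps on
the cells do not meet this set. -/
def gappedSet (i : Fin d) (s r : ℝ) {m : ℕ} (c : Fin m → Ctx d) : Set (Ctx d) :=
  slab i s ∪ ⋃ j, Metric.closedBall (c j) r

section gappedSet

variable {i : Fin d} {s s₀ r h ρ : ℝ} {m : ℕ} {c : Fin m → Ctx d}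

theorem isCompact_gappedSet : IsCompact (gappedSet i s r c) :=
  isCompact_Icc.union (isCompact_iUnion fun j => isCompact_closedBall (c j) r)

theorem gappedSet_subset_cube (hs : s ≤ 1) (hs₀ : 0 ≤ s₀) (hr : r < h)
    (hc : ∀ j i, s₀ + h ≤ c j i ∧ c j i + h ≤ 1) : gappedSet i s r c ⊆ cube d := by
  refine Set.union_subset (Set.Icc_subset_Icc_right fun j => ?_) (Set.iUnion_subset fun j =>
    (Metric.closedBall_subset_ball hr).trans (ball_subset_cube hs₀ (hc j)))
  by_cases hj : j = i
  · subst hj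
    simpa using hs
  · simp [hj]

theorem disjoint_slab_ball (hs : s ≤ s₀) (hc : ∀ j i, s₀ + h ≤ c j i ∧ c j i + h ≤ 1) (j : Fin m) :
    Disjoint (slab i s) (Metric.ball (c j) h) := by
  refine Set.disjoint_left.2 fun x hx hxj => ?_
  have h1 : x i ≤ s := by simpa using hx.2 i
  have h2 : |x i - c j i| < h := (dist_le_pi_dist x (c j) i).trans_lt hxj
  have h3 := (abs_lt.1 h2).1
  have h4 := (hc j i).1
  linarith

theorem volume_gappedSet (hs : s ≤ s₀) (hr0 : 0 ≤ r) (hr : r < h) (hs0 : 0 ≤ s)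
    (hc : ∀ j i, s₀ + h ≤ c j i ∧ c j i + h ≤ 1)
    (hdisj : Pairwise (Function.onFun Disjoint fun j => Metric.ball (c j) h)) :
    volume (gappedSet i s r c) = ENNReal.ofReal (s + m * (2 * r) ^ d) := by
  have hsub : ∀ j, Metric.closedBall (c j) r ⊆ Metric.ball (c j) h := fun j =>
    Metric.closedBall_subset_ball hr
  rw [gappedSet, measure_union (Set.disjoint_iUnion_right.2 fun j =>
      (disjoint_slab_ball hs hc j).mono_right (hsub j))
    (MeasurableSet.iUnion fun j => Metric.isClosed_closedBall.measurableSet), volume_slab,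
    measure_iUnion (fun j k hjk => (hdisj hjk).mono (hsub j) (hsub k))
      fun j => Metric.isClosed_closedBall.measurableSet, tsum_fintype]
  simp only [Real.volume_pi_closedBall _ hr0, Fintype.card_fin, Finset.sum_const,
    Finset.card_univ, nsmul_eq_mul]
  rw [ENNReal.ofReal_add hs0 (by positivity), ENNReal.ofReal_mul (by positivity),
    ENNReal.ofReal_natCast]

theorem ball_inter_gappedSet (hs : s ≤ s₀) (hr : r < h)
    (hc : ∀ j i, s₀ + h ≤ c j i ∧ c j i + h ≤ 1)
    (hdisj : Pairwise (Function.onFun Disjoint fun j => Metric.ball (c j) h)) (j : Fin m) :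
    Metric.ball (c j) h ∩ gappedSet i s r c = Metric.closedBall (c j) r := by
  have hsub : ∀ j, Metric.closedBall (c j) r ⊆ Metric.ball (c j) h := fun j =>
    Metric.closedBall_subset_ball hr
  refine Set.Subset.antisymm ?_ fun x hx =>
    ⟨hsub j hx, Or.inr (Set.mem_iUnion.2 ⟨j, hx⟩)⟩
  rintro x ⟨hxj, hx | hx⟩
  · exact absurd hxj (Set.disjoint_left.1 (disjoint_slab_ball hs hc j) hx)
  · obtain ⟨k, hk⟩ := Set.mem_iUnion.1 hx
    by_cases hjk : j = k
    · rwa [hjk]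
    · exact absurd (hsub k hk) (Set.disjoint_left.1 (hdisj hjk) hxj)

end gappedSet


/-! ### Scaling of the cells with the horizon -/

section scaling

variable {d : ℕ} {α β : ℝ}

theorem exists_forall_width_le (hβ : 0 < β) {η : ℝ} (hη : 0 < η) :
    ∃ T₀ : ℕ, ∀ T : ℕ, T₀ ≤ T → 0 < T ∧ (T : ℝ) ^ (-(1 / (2 * β + d))) ≤ η := by
  have hpos : 0 < 1 / (2 * β + d) := by positivity
  have h1 := (tendsto_rpow_neg_atTop hpos).comp (tendsto_natCast_atTop_atTop (R := ℝ))
  have h2 := (h1.eventually (ge_mem_nhds hη)).and (Filter.eventually_gt_atTop 0)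
  obtain ⟨T₀, hT₀⟩ := Filter.eventually_atTop.1 h2
  exact ⟨T₀, fun T hT => ⟨(hT₀ T hT).2, (hT₀ T hT).1⟩⟩

/-- With this width, the information gathered in one cell stays bounded. -/
theorem mul_width_eq_one (hβ : 0 < β) {T : ℕ} (hT : 0 < T) {h : ℝ}
    (hh : h = (T : ℝ) ^ (-(1 / (2 * β + d)))) : T * ((h ^ β) ^ 2 * h ^ d) = 1 := by
  have hT' : (0 : ℝ) < T := by exact_mod_cast hT
  have hpos : 0 < 2 * β + d := by positivity
  rw [hh, ← Real.rpow_natCast _ 2, ← Real.rpow_natCast _ d, ← Real.rpow_mul hT'.le,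
    ← Real.rpow_mul hT'.le, ← Real.rpow_mul hT'.le, ← Real.rpow_add hT']
  nth_rw 1 [← Real.rpow_one (T : ℝ)]
  rw [← Real.rpow_add hT', ← Real.rpow_zero (T : ℝ)]
  congr 1
  push_cast
  field_simp
  ring

theorem width_rate (hβ : 0 < β) {T : ℕ} (hT : 0 < T) {h : ℝ}
    (hh : h = (T : ℝ) ^ (-(1 / (2 * β + d)))) :
    (T : ℝ) ^ (1 - β * (α + 1) / (2 * β + d)) = T * (h ^ (α * β) * h ^ β) := by
  have hT' : (0 : ℝ) < T := by exact_mod_cast hT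
  have hpos : 0 < 2 * β + d := by positivity
  rw [hh, ← Real.rpow_mul hT'.le, ← Real.rpow_mul hT'.le, ← Real.rpow_add hT']
  nth_rw 2 [← Real.rpow_one (T : ℝ)]
  rw [← Real.rpow_add hT']
  congr 1
  field_simp
  ring

theorem rate_le_regret_bound (hβ : 0 < β) {T m : ℕ} (hT : 0 < T) {h a ϑ K : ℝ}
    (hh : h = (T : ℝ) ^ (-(1 / (2 * β + d)))) (hK : 0 ≤ K) (ha : 0 ≤ a)
    (hm : ϑ * h ^ (α * β) ≤ m * h ^ d) :
    K * a * ϑ / 8 * (T : ℝ) ^ (1 - β * (α + 1) / (2 * β + d)) ≤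
      T * m * (K * h ^ d * (a * h ^ β)) / 8 := by
  have hh0 : 0 ≤ h := hh ▸ Real.rpow_nonneg (Nat.cast_nonneg _) _
  rw [width_rate hβ hT hh]
  calc K * a * ϑ / 8 * (T * (h ^ (α * β) * h ^ β))
      = K * a / 8 * T * h ^ β * (ϑ * h ^ (α * β)) := by ring
    _ ≤ K * a / 8 * T * h ^ β * (m * h ^ d) := by gcongr
    _ = _ := by ring

/-- The proportion `ϑ` of occupied cells allowed by the margin condition. The term `h ^ d` accounts
for rounding the number of cells up; it is of lower order unless `α * β = d`, and then the constant
`C₀` has to be large enough for a single cell. -/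
theorem exists_scale {C₀ D ϑmax : ℝ} (hC₀ : 0 < C₀) (hD : 0 < D) (hϑ0 : 0 < ϑmax)
    (hϑ1 : ϑmax ≤ 1) (hαd : α * β ≤ d) (hcase : α * β < d ∨ 2 * D ≤ C₀) :
    ∃ ϑ η : ℝ, 0 < ϑ ∧ ϑ ≤ ϑmax ∧ 0 < η ∧ ∀ h : ℝ, 0 < h → h ≤ 1 → h ≤ η →
      ϑ * h ^ (α * β) + h ^ d ≤ C₀ / D * h ^ (α * β) := by
  rcases hcase with hlt | hle
  · set ϑ := min ϑmax (C₀ / (2 * D)) with hϑ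
    have hϑpos : 0 < ϑ := by positivity
    have he : 0 < d - α * β := by linarith
    refine ⟨ϑ, ϑ ^ (1 / (d - α * β)), hϑpos, min_le_left _ _, by positivity,
      fun h hh hh1 hhη => ?_⟩
    have h1 : h ^ (d - α * β) ≤ ϑ := by
      calc h ^ (d - α * β) ≤ (ϑ ^ (1 / (d - α * β))) ^ (d - α * β) :=
            Real.rpow_le_rpow hh.le hhη he.le
        _ = ϑ := by rw [← Real.rpow_mul hϑpos.le, one_div_mul_cancel he.ne', Real.rpow_one]
    have h2 : h ^ d = h ^ (d - α * β) * h ^ (α * β) := by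
      rw [← Real.rpow_add hh, sub_add_cancel, Real.rpow_natCast]
    have h3 : ϑ ≤ C₀ / (2 * D) := min_le_right _ _
    have h4 : 2 * (C₀ / (2 * D)) = C₀ / D := by field_simp
    have h5 : 0 < h ^ (α * β) := by positivity
    rw [h2, ← add_mul]
    refine mul_le_mul_of_nonneg_right ?_ h5.le
    linarith
  · refine ⟨ϑmax, 1, hϑ0, le_rfl, one_pos, fun h hh hh1 _ => ?_⟩
    have h1 : h ^ d ≤ h ^ (α * β) := by
      rw [← Real.rpow_natCast]
      exact Real.rpow_le_rpow_of_exponent_ge hh hh1 hαd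
    have h2 : 2 ≤ C₀ / D := (le_div_iff₀ hD).2 hle
    have h3 : 0 < h ^ (α * β) := by positivity
    nlinarith

theorem margin_constant_le {C₀ K a h x : ℝ} (hK : 0 < K) (ha : 0 < a) (hh : 0 < h)
    (hx : x ≤ C₀ / (K * a ^ (-α)) * h ^ (α * β)) : x * K * (a * h ^ β) ^ (-α) ≤ C₀ := by
  have h1 : (a * h ^ β) ^ (-α) = a ^ (-α) * (h ^ (α * β))⁻¹ := by
    rw [Real.mul_rpow ha.le (Real.rpow_nonneg hh.le _), ← Real.rpow_mul hh.le,
      ← Real.rpow_neg hh.le]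
    congr 2
    ring
  have h2 : 0 < a ^ (-α) := by positivity
  have h3 : 0 < h ^ (α * β) := by positivity
  rw [h1]
  calc x * K * (a ^ (-α) * (h ^ (α * β))⁻¹)
      ≤ C₀ / (K * a ^ (-α)) * h ^ (α * β) * K * (a ^ (-α) * (h ^ (α * β))⁻¹) := by gcongr
    _ = C₀ := by field_simp

theorem information_le {T : ℕ} {a h ρ : ℝ} (hβ : 0 < β) (hT : 0 < T)
    (hh : h = (T : ℝ) ^ (-(1 / (2 * β + d)))) (hρ : 0 < ρ) (ha0 : 0 ≤ a) (ha1 : a ≤ 1)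
    (ha : a ≤ 1 / (16 * ρ * 2 ^ d)) :
    T * ((2 * (a * h ^ β)) ^ 2 * (ρ * (2 * h) ^ d)) ≤ 1 / 4 := by
  have h1 := mul_width_eq_one (d := d) hβ hT hh
  have h2 : a * a ≤ 1 / (16 * ρ * 2 ^ d) := (mul_le_of_le_one_left ha0 ha1).trans ha
  rw [le_div_iff₀ (by positivity)] at h2
  calc T * ((2 * (a * h ^ β)) ^ 2 * (ρ * (2 * h) ^ d))
      = 4 * ρ * 2 ^ d * (a * a) * (T * ((h ^ β) ^ 2 * h ^ d)) := by
        rw [mul_pow 2 h]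
        ring
    _ ≤ 1 / 4 := by
        rw [h1]
        linarith

end scaling

/-! ### The lower bounds for the two classes -/

theorem le_worstRegret {d : ℕ} {π : Policy.{u} d} {Q : Set (Instance d)} {T : ℕ} {P : Instance d}
    (hP : P ∈ Q) {r : ℝ} (h : r ≤ π.regret P T) : (r : EReal) ≤ worstRegret π Q T :=
  le_iSup₂_of_le P hP (EReal.coe_le_coe_iff.2 h)

section classes

variable {d n : ℕ} {γ β βbar L α C₀ ρlo ρhi b l₀ c₁ MG B : ℝ} {G : ℝ → ℝ}

/-- The height, relative to `h ^ β`, of tents of width `h`. The three bounds keep the payoffs in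
`[1 / 4, 3 / 4]`, keep the Hölder constant of the perturbation below `L / 2`, and bound the
information gathered in one cell; the factor `1` is the density of the contexts. -/
noncomputable def tentHeight (d : ℕ) (L : ℝ) : ℝ :=
  min (1 / 8) (min (L / 4) (1 / (16 * 1 * 2 ^ d)))

theorem tentHeight_pos (d : ℕ) {L : ℝ} (hL : 0 < L) : 0 < tentHeight d L := by
  unfold tentHeight
  positivity

/-- The lower bound with tents and uniformly distributed contexts. -/
theorem exists_rate_le_worstRegret_Pss (i : Fin d) (hγ : 0 < γ) (hn : strictFloor β = n)
    (hβ : β = n + γ) (hG : HolderDeriv n γ MG G) (hMG : 0 ≤ MG) (hGB : ∀ t, |G t| ≤ B)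
    (hGpow : ∀ t, 0 ≤ t → t ≤ 1 → G t = t ^ (n + γ))
    (hc₁ : 0 ≤ c₁) (hcB : c₁ * B ≤ 1 / 8 * (2 : ℝ) ^ (l₀ * β)) (hcL : c₁ * MG ≤ L / 2)
    (hb : b ≤ c₁ * powGap β (strictFloor βbar)) (hL : 0 < L) (hα : 0 < α) (hβ1 : β ≤ 1)
    (hαβ : α ≤ 1 / β) (hαd : α * β ≤ d) (hC₀ : 0 < C₀) (hlo : ρlo ≤ 1) (hhi : 1 ≤ ρhi)
    (hcase : α * β < d ∨ 2 * (d * 2 ^ d * tentHeight d L ^ (-α)) ≤ C₀) :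
    ∃ T₀ : ℕ, ∃ C : ℝ, 0 < C ∧ ∀ T : ℕ, T₀ ≤ T → ∀ π : Policy.{u} d,
      ((C * (T : ℝ) ^ (1 - β * (α + 1) / (2 * β + d)) : ℝ) : EReal) ≤
        worstRegret π (Pss d β βbar L α C₀ ρlo ρhi b l₀) T := by
  have hβ0 : 0 < β := by rw [hβ]; positivity
  have hd : 0 < d := i.pos
  have hn0 : n = 0 := by
    rw [← hn, strictFloor]
    have : ⌈β⌉₊ ≤ 1 := Nat.ceil_le.2 (by simpa using hβ1)
    omega
  subst hn0
  have hβγ : γ = β := by simp [hβ]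
  subst hβγ
  set a := tentHeight d L with ha
  have ha0 : 0 < a := tentHeight_pos d hL
  have ha8 : a ≤ 1 / 8 := min_le_left _ _
  have haL : a ≤ L / 4 := (min_le_right _ _).trans (min_le_left _ _)
  have haρ : a ≤ 1 / (16 * 1 * 2 ^ d) := (min_le_right _ _).trans (min_le_right _ _)
  set K : ℝ := d * 2 ^ d with hK
  have hK0 : 0 < K := by positivity
  have hD : 0 < K * a ^ (-α) := by positivity
  obtain ⟨ϑ, η, hϑ0, hϑ1, hη0, hscale⟩ := exists_scale (d := d) (ϑmax := ((1 - 0) / 4) ^ d) hC₀ hD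
    (by positivity) (pow_le_one₀ (by norm_num) (by norm_num)) hαd hcase
  obtain ⟨T₀, hT₀⟩ := exists_forall_width_le (d := d) hβ0 (η := min η (1 / 2)) (by positivity)
  refine ⟨T₀, 1 / 2 * a * ϑ / 8, by positivity, fun T hT π => ?_⟩
  obtain ⟨hTpos, hwidth⟩ := hT₀ T hT
  have hT' : (0 : ℝ) < T := by exact_mod_cast hTpos
  set h : ℝ := (T : ℝ) ^ (-(1 / (2 * γ + d))) with hh
  have hh0 : 0 < h := by positivity
  have hhη : h ≤ η := hwidth.trans (min_le_left _ _)
  have hh2 : h ≤ 1 / 2 := hwidth.trans (min_le_right _ _)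
  have hh1 : h ≤ 1 := hh2.trans (by norm_num)
  obtain ⟨m, c, hc, hdisj, hmlo, hmhi⟩ := exists_cells (d := d) (s₀ := 0) hh0 hh1 (by linarith) hϑ0
    hϑ1 (mul_pos hα hβ0).le
  have hprob : ENNReal.ofReal 1 * volume (cube d) = 1 := by
    rw [cube, Real.volume_Icc_pi]
    simp
  obtain ⟨P, hPX, hPH, hPM, hPS, hPR⟩ := exists_hard_instance (T := T) (Ψ := tent γ) (K := K)
    (K' := 1 / 2) (w := 1 * (2 * h) ^ d) (C₀ := C₀) (α := α) π
    (isProbabilityMeasure_constDensity hprob)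
    (constDensity_cube_compl le_rfl) i hγ hn hβ hG hMG hGB hGpow
    (holderDeriv_tent hβ0 hβ1) zero_le_one
    (fun x => posPow_nonneg _ _) (tent_le_one hβ0) (fun x hx => tent_eq_zero hβ0 hx)
    (fun x hx => by
      rw [iteratedFDeriv_zero_eq_comp, Function.comp_apply, tent_eq_zero hβ0 hx, map_zero])
    hh0 hh1 hdisj ha0 ha8 (by linarith) hc₁ hcB hcL hb
    (fun r hr => constDensity_Icc_ne_zero one_pos one_pos le_rfl hr)
    (fun j δ hδ => by
      rw [constDensity, withDensity_const, Measure.smul_apply, smul_eq_mul, ENNReal.ofReal_one,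
        one_mul]
      exact (Measure.restrict_apply_le _ _).trans
        (volume_tent_le hβ0 hαβ hα.le hh0 (by positivity) hδ hd (c j)))
    (margin_constant_le hK0 ha0 hh0 (hmhi.trans (hscale h hh0 hh1 hhη)))
    (fun j => constDensity_real_ball_le _ zero_le_one hh0 (c j))
    (fun j => half_le_lintegral_tent hβ0 hβ1 hh0 (by positivity)
      (ball_subset_cube le_rfl (hc j)))
    (information_le hβ0 hTpos hh one_pos ha0.le (ha8.trans (by norm_num)) haρ)
  have hmem : P ∈ Pss d γ βbar L α C₀ ρlo ρhi b l₀ :=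
    ⟨hPH, by rw [hPX]; exact densityOn_constDensity hlo hhi, hPM, hPS⟩
  exact le_worstRegret hmem
    ((rate_le_regret_bound hβ0 hTpos hh (by norm_num) ha0.le hmlo).trans hPR)

/-- The lower bound with plateau bumps and a context distribution with gaps. The density is `ρhi` on
its support, which has the volume `1 / ρhi < 1`; the bumps live in the region `x_i ≥ 1 / ρhi`, and
the height `s` of the slab makes up for the mass on the plateaus. -/
theorem exists_rate_le_worstRegret_PssTilde (i : Fin d) (hγ : 0 < γ) (hγ1 : γ ≤ 1)
    (hn : strictFloor β = n)
    (hβ : β = n + γ) (hG : HolderDeriv n γ MG G) (hMG : 0 ≤ MG) (hGB : ∀ t, |G t| ≤ B)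
    (hGpow : ∀ t, 0 ≤ t → t ≤ 1 → G t = t ^ (n + γ))
    (hc₁ : 0 ≤ c₁) (hcB : c₁ * B ≤ 1 / 8 * (2 : ℝ) ^ (l₀ * β)) (hcL : c₁ * MG ≤ L / 2)
    (hb : b ≤ c₁ * powGap β (strictFloor βbar)) (hL : 0 < L) (hα : 0 < α)
    (hαd : α * β ≤ d) (hC₀ : 0 < C₀) (hlohi : ρlo ≤ ρhi) (hhi : 1 < ρhi) :
    ∃ T₀ : ℕ, ∃ C : ℝ, 0 < C ∧ ∀ T : ℕ, T₀ ≤ T → ∀ π : Policy.{u} d,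
      ((C * (T : ℝ) ^ (1 - β * (α + 1) / (2 * β + d)) : ℝ) : EReal) ≤
        worstRegret π (PssTilde d β βbar L α C₀ ρlo ρhi b l₀) T := by
  have hβ0 : 0 < β := by rw [hβ]; positivity
  have hd : 0 < d := i.pos
  have hρ0 : 0 < ρhi := by linarith
  obtain ⟨Ψ, M, hM, hΨ, hΨ0, hΨ1, hΨplat, hΨsupp, hΨsupp'⟩ :=
    exists_plateau (d := d) n hγ hγ1
  set a : ℝ := min (1 / 8) (min (L / (4 * M)) (1 / (16 * ρhi * 2 ^ d))) with ha
  have ha0 : 0 < a := by positivity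
  have ha8 : a ≤ 1 / 8 := min_le_left _ _
  have haL : a * (4 * M) ≤ L := (le_div_iff₀ (by positivity)).1
    ((min_le_right _ _).trans (min_le_left _ _))
  have haρ : a ≤ 1 / (16 * ρhi * 2 ^ d) := (min_le_right _ _).trans (min_le_right _ _)
  -- the relative size of the plateaus that carry mass
  set θ : ℝ := min (1 / 4) (min (1 / (8 * ρhi)) (C₀ / (4 * ρhi * a ^ (-α)))) with hθ
  have hθ0 : 0 < θ := by positivity
  have hθ4 : θ ≤ 1 / 4 := min_le_left _ _
  have hθρ : θ * (8 * ρhi) ≤ 1 := (le_div_iff₀ (by positivity)).1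
    ((min_le_right _ _).trans (min_le_left _ _))
  have hθC : θ * (4 * ρhi * a ^ (-α)) ≤ C₀ := (le_div_iff₀ (by positivity)).1
    ((min_le_right _ _).trans (min_le_right _ _))
  have hθd : (2 * θ) ^ d ≤ 2 * θ := pow_le_of_le_one (by positivity) (by linarith) hd.ne'
  set K : ℝ := ρhi * (2 * θ) ^ d with hK
  have hK0 : 0 < K := by positivity
  have hD : 0 < K * a ^ (-α) := by positivity
  have hDC : 2 * (K * a ^ (-α)) ≤ C₀ := by
    refine le_trans ?_ hθC
    calc 2 * (ρhi * (2 * θ) ^ d * a ^ (-α)) ≤ 2 * (ρhi * (2 * θ) * a ^ (-α)) := by gcongr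
      _ = _ := by ring
  set s₀ : ℝ := 1 / ρhi with hs₀
  have hs₀0 : 0 < s₀ := by positivity
  have hs₀1 : s₀ < 1 := (div_lt_one hρ0).2 hhi
  have hquart : (1 - s₀) / 4 ≤ 1 := by linarith
  have hquart0 : 0 < (1 - s₀) / 4 := by linarith
  obtain ⟨ϑ, η, hϑ0, hϑ1, hη0, hscale⟩ := exists_scale (d := d) (ϑmax := ((1 - s₀) / 4) ^ d) hC₀ hD
    (by positivity) (pow_le_one₀ hquart0.le hquart) hαd (Or.inr hDC)
  obtain ⟨T₀, hT₀⟩ := exists_forall_width_le (d := d) hβ0 (η := min η ((1 - s₀) / 2))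
    (lt_min hη0 (by linarith))
  refine ⟨T₀, K * a * ϑ / 8, by positivity, fun T hT π => ?_⟩
  obtain ⟨hTpos, hwidth⟩ := hT₀ T hT
  have hT' : (0 : ℝ) < T := by exact_mod_cast hTpos
  set h : ℝ := (T : ℝ) ^ (-(1 / (2 * β + d))) with hh
  have hh0 : 0 < h := by positivity
  have hhη : h ≤ η := hwidth.trans (min_le_left _ _)
  have hh2 : h ≤ (1 - s₀) / 2 := hwidth.trans (min_le_right _ _)
  have hh1 : h ≤ 1 := by linarith
  obtain ⟨m, c, hc, hdisj, hmlo, hmhi⟩ := exists_cells (d := d) (s₀ := s₀) hh0 hh1 (by linarith)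
    hϑ0 hϑ1 (mul_pos hα hβ0).le
  set ε := a * h ^ β with hε
  have hε0 : 0 < ε := by positivity
  set r := θ * h with hr
  have hr0 : 0 < r := by positivity
  have hrh : r < h := by nlinarith
  -- the plateaus have total probability at most one half
  have hmass : m * (2 * r) ^ d ≤ s₀ / 2 := by
    have h1 : h ^ (α * β) ≤ 1 := Real.rpow_le_one hh0.le hh1 (mul_pos hα hβ0).le
    have h2 : h ^ d ≤ 1 := pow_le_one₀ hh0.le hh1
    have h3 : ϑ ≤ 1 := hϑ1.trans (pow_le_one₀ hquart0.le hquart)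
    have h4 : m * h ^ d ≤ 2 := by
      have : ϑ * h ^ (α * β) ≤ 1 * 1 := mul_le_mul h3 h1 (by positivity) zero_le_one
      linarith
    calc m * (2 * r) ^ d = m * h ^ d * (2 * θ) ^ d := by
          rw [hr, ← mul_assoc, mul_pow]
          ring
      _ ≤ 2 * (2 * θ) := mul_le_mul h4 hθd (by positivity) zero_le_two
      _ ≤ s₀ / 2 := by
          rw [hs₀, div_div, le_div_iff₀ (by positivity)]
          linarith
  set s := s₀ - m * (2 * r) ^ d with hs
  have hs0 : 0 < s := by linarith
  have hss₀ : s ≤ s₀ := by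
    have : 0 ≤ m * (2 * r) ^ d := by positivity
    linarith
  set S := gappedSet i s r c with hS
  have hScube : S ⊆ cube d := gappedSet_subset_cube (by linarith) hs₀0.le hrh hc
  have hprob : ENNReal.ofReal ρhi * volume S = 1 := by
    rw [hS, volume_gappedSet hss₀ hr0.le hrh hs0.le hc hdisj, hs, sub_add_cancel,
      ← ENNReal.ofReal_mul hρ0.le, hs₀, mul_one_div_cancel hρ0.ne', ENNReal.ofReal_one]
  have hball : ∀ j, Metric.ball (c j) h ∩ S = Metric.closedBall (c j) r :=
    ball_inter_gappedSet hss₀ hrh hc hdisj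
  have hvol : ∀ j, ENNReal.ofReal ρhi * volume (Metric.closedBall (c j) r) =
      ENNReal.ofReal (K * h ^ d) := fun j => by
    rw [Real.volume_pi_closedBall _ hr0.le, Fintype.card_fin, ← ENNReal.ofReal_mul hρ0.le]
    congr 1
    rw [hK, hr, mul_assoc, ← mul_pow]
    ring
  have hplat : ∀ j, ∀ x ∈ Metric.closedBall (c j) r, Ψ (h⁻¹ • (x - c j)) = 1 := fun j x hx => by
    refine hΨplat _ ?_
    rw [mem_closedBall_iff_norm] at hx
    rw [mem_closedBall_zero_iff, norm_smul, norm_inv, Real.norm_of_nonneg hh0.le,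
      inv_mul_le_iff₀ hh0]
    refine hx.trans ?_
    rw [hr, mul_comm h]
    gcongr
  obtain ⟨P, hPX, hPH, hPM, hPS, hPR⟩ := exists_hard_instance (T := T) (K := K) (K' := K)
    (w := ρhi * (2 * h) ^ d) (C₀ := C₀) (α := α) π
    (isProbabilityMeasure_constDensity hprob)
    (constDensity_cube_compl hScube) i hγ hn hβ hG hMG hGB hGpow
    hΨ hM.le hΨ0 hΨ1 hΨsupp hΨsupp' hh0 hh1 hdisj ha0 ha8 (by linarith) hc₁ hcB hcL hb
    (fun r' hr' => constDensity_Icc_ne_zero hρ0 hs0 (fun x hx => Or.inl ⟨hx.1, fun k => by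
      by_cases hk : k = i
      · subst hk
        simpa using hx.2 k
      · simpa [hk] using (hx.2 k).trans (by linarith : s ≤ 1)⟩) hr')
    (fun j δ hδ => by
      rcases lt_or_ge δ ε with hδε | hδε
      · -- a level below the height of the plateau is attained off `S` only
        have hsub : {x | x ∈ Metric.ball (c j) h ∧ 0 < Ψ (h⁻¹ • (x - c j)) ∧
            ε * Ψ (h⁻¹ • (x - c j)) ≤ δ} ⊆
            Metric.ball (c j) h \ Metric.closedBall (c j) r := fun x hx =>
          ⟨hx.1, fun hx' => by
            have := hx.2.2
            rw [hplat j x hx', mul_one] at this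
            linarith⟩
        refine (measure_mono hsub).trans ?_
        rw [constDensity_apply _ _ (Metric.isOpen_ball.measurableSet.diff
          Metric.isClosed_closedBall.measurableSet), ← hball j]
        have : (Metric.ball (c j) h \ (Metric.ball (c j) h ∩ S)) ∩ S = ∅ := by
          ext x
          simp only [Set.mem_inter_iff, Set.mem_sdiff, Set.mem_empty_iff_false, iff_false]
          tauto
        rw [this, measure_empty, mul_zero]
        exact zero_le
      · refine (measure_mono (t := Metric.ball (c j) h) fun x hx => hx.1).trans ?_
        rw [constDensity_apply _ _ Metric.isOpen_ball.measurableSet, hball, hvol]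
        refine ENNReal.ofReal_le_ofReal (le_mul_of_one_le_right (by positivity) ?_)
        exact Real.one_le_rpow ((one_le_div₀ hε0).2 hδε) hα.le)
    (margin_constant_le hK0 ha0 hh0 (hmhi.trans (hscale h hh0 hh1 hhη)))
    (fun j => constDensity_real_ball_le _ hρ0.le hh0 (c j))
    (fun j => by
      have hsub : Metric.closedBall (c j) r ⊆ Metric.ball (c j) h :=
        Metric.closedBall_subset_ball hrh
      calc ENNReal.ofReal (K * h ^ d * ε)
          = ENNReal.ofReal ε * constDensity S ρhi (Metric.closedBall (c j) r) := by
            have hcS : Metric.closedBall (c j) r ∩ S = Metric.closedBall (c j) r := by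
              rw [← hball j, Set.inter_assoc, Set.inter_self]
            rw [constDensity_apply _ _ Metric.isClosed_closedBall.measurableSet, hcS, hvol,
              ← ENNReal.ofReal_mul hε0.le, mul_comm]
        _ = ∫⁻ _ in Metric.closedBall (c j) r, ENNReal.ofReal ε ∂(constDensity S ρhi) :=
            (setLIntegral_const _ _).symm
        _ = ∫⁻ x in Metric.closedBall (c j) r, ENNReal.ofReal (ε * Ψ (h⁻¹ • (x - c j)))
              ∂(constDensity S ρhi) :=
            setLIntegral_congr_fun Metric.isClosed_closedBall.measurableSet fun x hx => by
              simp only [hplat j x hx, mul_one]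
        _ ≤ _ := lintegral_mono_set hsub)
    (information_le hβ0 hTpos hh hρ0 ha0.le (ha8.trans (by norm_num)) haρ)
  have hmem : P ∈ PssTilde d β βbar L α C₀ ρlo ρhi b l₀ :=
    ⟨hPH, ⟨S, isCompact_gappedSet, hScube, by
      rw [hPX]
      exact densityOn_constDensity hlohi le_rfl⟩, hPM, hPS⟩
  exact le_worstRegret hmem ((rate_le_regret_bound hβ0 hTpos hh hK0.le ha0.le hmlo).trans hPR)

end classes

end ContextualBandit

theorem theorem2 (d : ℕ) (β βbar α : ℝ) (hβ : 0 < β) (hβint : ∀ n : ℤ, β ≠ n) (hβbar : β ≤ βbar)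
    (hα : 0 < α) (hαβ : α ≤ max 1 (1 / β)) (hαd : α * β ≤ d) :
    ∃ κ : ℝ, 0 < κ ∧ ∀ L : ℝ, 0 < L → ∃ Cstar : ℝ, 0 < Cstar ∧
      ∀ C₀ ρlo ρhi b l₀ : ℝ, 0 < C₀ → 0 < ρlo → ρlo ≤ ρhi → 0 < b → 0 ≤ l₀ →
        b ≤ κ * min L ((2 : ℝ) ^ (l₀ * β)) →
        (β ≤ 1 → ρlo ≤ 1 → 1 ≤ ρhi → (α * β < d ∨ Cstar ≤ C₀) →
          ∃ T₀ : ℕ, ∃ C : ℝ, 0 < C ∧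
            ∀ T : ℕ, T₀ ≤ T → ∀ π : ContextualBandit.Policy.{u} d,
              ((C * (T : ℝ) ^ (1 - β * (α + 1) / (2 * β + d)) : ℝ) : EReal) ≤
                ContextualBandit.worstRegret π
                  (ContextualBandit.Pss d β βbar L α C₀ ρlo ρhi b l₀) T) ∧
        (1 ≤ β → 1 < ρhi →
          ∃ T₀ : ℕ, ∃ C : ℝ, 0 < C ∧
            ∀ T : ℕ, T₀ ≤ T → ∀ π : ContextualBandit.Policy.{u} d,
              ((C * (T : ℝ) ^ (1 - β * (α + 1) / (2 * β + d)) : ℝ) : EReal) ≤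
                ContextualBandit.worstRegret π
                  (ContextualBandit.PssTilde d β βbar L α C₀ ρlo ρhi b l₀) T) := by
  have hd : 0 < d := by
    have : (0 : ℝ) < d := (mul_pos hα hβ).trans_le hαd
    exact_mod_cast this
  let i : Fin d := ⟨0, hd⟩
  obtain ⟨n, hn⟩ : ∃ n, ContextualBandit.strictFloor β = n := ⟨_, rfl⟩
  obtain ⟨γ, hγ⟩ : ∃ γ : ℝ, γ = β - n := ⟨_, rfl⟩
  have hceil : 1 ≤ ⌈β⌉₊ := Nat.one_le_ceil_iff.2 hβ
  have hcast : ((n : ℕ) : ℝ) + 1 = ⌈β⌉₊ := by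
    rw [ContextualBandit.strictFloor] at hn
    exact_mod_cast (by omega : n + 1 = ⌈β⌉₊)
  have hγ0 : 0 < γ := by
    have := Nat.ceil_lt_add_one hβ.le
    linarith
  have hγ1 : γ ≤ 1 := by
    have := Nat.le_ceil β
    linarith
  have hβn : β = n + γ := by linarith
  obtain ⟨G, MG, B, hMG, hB, hG, hGB, hGpow⟩ := ContextualBandit.exists_rough_profile hγ0 hγ1 n
  -- `κ₁` keeps the Hölder constant of the rough payoff at most `L / 2`, and its deviation from
  -- `1 / 2` at most `1 / 8`
  set κ₁ := min (1 / (2 * MG)) (1 / (8 * B)) with hκ₁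
  have hκ₁0 : 0 < κ₁ := by positivity
  have hκM : κ₁ * (2 * MG) ≤ 1 := (le_div_iff₀ (by positivity)).1 (min_le_left _ _)
  have hκB : κ₁ * (8 * B) ≤ 1 := (le_div_iff₀ (by positivity)).1 (min_le_right _ _)
  have hgap := ContextualBandit.powGap_pos hβint (ContextualBandit.strictFloor βbar)
  refine ⟨κ₁ * ContextualBandit.powGap β (ContextualBandit.strictFloor βbar), by positivity,
    fun L hL => ⟨2 * (d * 2 ^ d * ContextualBandit.tentHeight d L ^ (-α)), ?_, ?_⟩⟩
  · have := ContextualBandit.tentHeight_pos d hL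
    have hd' : (0 : ℝ) < d := by exact_mod_cast hd
    positivity
  intro C₀ ρlo ρhi b l₀ hC₀ _ hlohi _ _ hb
  set c₁ := κ₁ * min L ((2 : ℝ) ^ (l₀ * β)) with hc₁
  have hc₁0 : 0 ≤ c₁ := by positivity
  have hcL : c₁ * MG ≤ L / 2 := by
    have h1 : c₁ * MG ≤ κ₁ * L * MG := by
      rw [hc₁]
      gcongr
      exact min_le_left _ _
    nlinarith
  have hcB : c₁ * B ≤ 1 / 8 * (2 : ℝ) ^ (l₀ * β) := by
    have h0 : (0 : ℝ) < (2 : ℝ) ^ (l₀ * β) := by positivity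
    have h1 : c₁ * B ≤ κ₁ * (2 : ℝ) ^ (l₀ * β) * B := by
      rw [hc₁]
      gcongr
      exact min_le_right _ _
    nlinarith
  have hb' : b ≤ c₁ * ContextualBandit.powGap β (ContextualBandit.strictFloor βbar) := by
    rw [hc₁]
    linarith
  refine ⟨fun hβ1 hlo hhi hcase => ?_, fun _ hhi => ?_⟩
  · have hαβ' : α ≤ 1 / β := by
      rwa [max_eq_right ((one_le_div₀ hβ).2 hβ1)] at hαβ
    exact ContextualBandit.exists_rate_le_worstRegret_Pss i hγ0 hn hβn hG hMG.le hGB hGpow hc₁0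
      hcB hcL hb' hL hα hβ1 hαβ' hαd hC₀ hlo hhi hcase
  · exact ContextualBandit.exists_rate_le_worstRegret_PssTilde i hγ0 hγ1 hn hβn hG hMG.le hGB
      hGpow hc₁0 hcB hcL hb' hL hα hαd hC₀ hlohi hhi
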